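/- Let $R$ be a unital ring with Jacobson radical $\mathcal J(R)$. Definitions. Elements $s,t\in R$ are centrally orthogonal if $sRt=0=tRs$. An element $u\in R$ is quasi-invertible if there are $a,b\in R$ such that $1-ua$ and $1-bu$ are centrally orthogonal. $R$ is a $QB$-ring if, whenever $xa+b=1$ with $x,a,b\in R$, there is $y\in R$ such that $a+yb$ is quasi-invertible. $R$ is an exchange ring if for every $a\in R$ there is an idempotent $p\in aR$ with $1-p\in(1-a)R$; it is semi-primitive if $\mathcal J(R)=0$. Let $\mathcal V(R)$ be the commutative monoid of isomorphism classes of finitely generated projective right $R$-modules, with addition induced by direct sum, preordered by $x\le y$ if $x+z=y$ for some $z\in\mathcal V(R)$, and put $\mathbf 1=[R_R]$. An order-ideal of $\mathcal V(R)$ is a submonoid $S$ such that $x\le y$ and $y\in S$ imply $x\in S$; two order-ideals $S,T$ are orthogonal if $S\cap T=\{0\}$. Theorem 8.7. Consider the following conditions on $R$: (i) $R$ is a $QB$-ring; (ii) whenever $n\cdot\mathbf 1+b_1=n\cdot\mathbf 1+b_2$ in $\mathcal V(R)$ for some integer $n\ge 1$, there are orthogonal order-ideals $S_1,S_2$ of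 $\mathcal V(R)$ and elements $x,c_1,c_2\in\mathcal V(R)$ with $c_i\in S_i$ for $i=1,2$, such that $b_1+c_1=b_2+c_2$ and $x+c_1=n\cdot\mathbf 1=x+c_2$; (iii) whenever $a+b_1=a+b_2$ in $\mathcal V(R)$, there are orthogonal order-ideals $S_1,S_2$ of $\mathcal V(R)$ and elements $c_1,c_2$ with $c_i\in S_i$ for $i=1,2$, such that $b_1+c_1=b_2+c_2$. Then (i) implies (ii), and (ii) implies (iii). If $R$ is a semi-primitive exchange ring, then (i), (ii) and (iii) are equivalent. -/

import Mathlib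

universe u

namespace QBRings

section Ring

variable {R : Type u} [Ring R]

/-- Central orthogonality of elements: `x R y = 0` and `y R x = 0`. -/
def CentrallyOrthogonal (x y : R) : Prop :=
  ∀ r : R, x * r * y = 0 ∧ y * r * x = 0

/-- `w` is quasi-invertible if `1 - w a` and `1 - b w` are centrally orthogonal for some `a, b`. -/
def IsQuasiInvertible (w : R) : Prop :=
  ∃ a b : R, CentrallyOrthogonal (1 - w * a) (1 - b * w)

/-- `cl A`: the elements `a` such that `x a + b = 1` implies `a + y b ∈ A` for some `y`. -/
def cl (A : Set R) : Set R :=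
  {a | ∀ x b : R, x * a + b = 1 → ∃ y : R, a + y * b ∈ A}

variable (R)

/-- A unital ring is a `QB`-ring if `cl` of its set of quasi-invertible elements is everything. -/
def IsQBRing : Prop :=
  cl {w : R | IsQuasiInvertible w} = Set.univ

/-- Exchange rings: each `a` admits an idempotent `p ∈ a R` with `1 - p ∈ (1 - a) R`. -/
def IsExchangeRing : Prop :=
  ∀ a : R, ∃ p : R, IsIdempotentElem p ∧ (∃ r : R, p = a * r) ∧ ∃ s : R, 1 - p = (1 - a) * s

/-- Semi-primitive rings: the Jacobson radical vanishes. -/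
def IsSemiprimitive : Prop :=
  Ring.jacobson R = ⊥

end Ring

section VMonoid

/-- A finitely generated projective right `R`-module (right modules are modules over `Rᵐᵒᵖ`). -/
structure FGProj (R : Type u) [Ring R] : Type (u + 1) where
  carrier : Type u
  [addCommGroup : AddCommGroup carrier]
  [module : Module Rᵐᵒᵖ carrier]
  [finite : Module.Finite Rᵐᵒᵖ carrier]
  [projective : Module.Projective Rᵐᵒᵖ carrier]

attribute [instance] FGProj.addCommGroup FGProj.module FGProj.finite FGProj.projective

variable (R : Type u) [Ring R]

/-- Right modules are identified when they are isomorphic. -/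
instance FGProj.setoid : Setoid (FGProj R) where
  r M N := Nonempty (M.carrier ≃ₗ[Rᵐᵒᵖ] N.carrier)
  iseqv :=
    ⟨fun _ => ⟨LinearEquiv.refl _ _⟩, fun ⟨e⟩ => ⟨e.symm⟩, fun ⟨e⟩ ⟨f⟩ => ⟨e.trans f⟩⟩

/-- The monoid of isomorphism classes of finitely generated projective right `R`-modules. -/
def V : Type (u + 1) := Quotient (FGProj.setoid R)

/-- The regular right module `R_R` is isomorphic to `Rᵐᵒᵖ` over `Rᵐᵒᵖ`. -/
def regularEquiv : Rᵐᵒᵖ ≃ₗ[Rᵐᵒᵖ] R where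
  toFun := MulOpposite.unop
  invFun := MulOpposite.op
  map_add' _ _ := rfl
  map_smul' _ _ := rfl
  left_inv _ := rfl
  right_inv _ := rfl

instance : Module.Finite Rᵐᵒᵖ R := Module.Finite.equiv (regularEquiv R)

instance : Module.Projective Rᵐᵒᵖ R := Module.Projective.of_equiv (regularEquiv R)

variable {R}

/-- The class `[M]` in `V R` of a finitely generated projective right module. -/
def V.mk (M : Type u) [AddCommGroup M] [Module Rᵐᵒᵖ M] [Module.Finite Rᵐᵒᵖ M]
    [Module.Projective Rᵐᵒᵖ M] : V R :=
  Quotient.mk (FGProj.setoid R) ⟨M⟩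

theorem V.mk_eq_mk {M N : Type u} [AddCommGroup M] [Module Rᵐᵒᵖ M] [Module.Finite Rᵐᵒᵖ M]
    [Module.Projective Rᵐᵒᵖ M] [AddCommGroup N] [Module Rᵐᵒᵖ N] [Module.Finite Rᵐᵒᵖ N]
    [Module.Projective Rᵐᵒᵖ N] :
    (V.mk M : V R) = V.mk N ↔ Nonempty (M ≃ₗ[Rᵐᵒᵖ] N) :=
  Quotient.eq (r := FGProj.setoid R)

/-- Addition on `V R` is induced by the direct sum. -/
def V.add : V R → V R → V R :=
  Quotient.map₂ (fun M N => ⟨M.carrier × N.carrier⟩)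
    (fun _ _ ⟨e⟩ _ _ ⟨f⟩ => ⟨e.prodCongr f⟩)

instance : Add (V R) := ⟨V.add⟩

/-- The class of the zero module. -/
instance : Zero (V R) := ⟨V.mk PUnit⟩

instance : AddCommMonoid (V R) where
  nsmul := nsmulRec
  add_assoc := by
    rintro ⟨M⟩ ⟨N⟩ ⟨P⟩
    exact Quotient.sound ⟨LinearEquiv.prodAssoc _ _ _ _⟩
  zero_add := by
    rintro ⟨M⟩
    exact Quotient.sound ⟨LinearEquiv.uniqueProd⟩
  add_zero := by
    rintro ⟨M⟩
    exact Quotient.sound ⟨LinearEquiv.prodUnique⟩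
  add_comm := by
    rintro ⟨M⟩ ⟨N⟩
    exact Quotient.sound ⟨LinearEquiv.prodComm _ _ _⟩

theorem V.mk_add_mk (M N : Type u) [AddCommGroup M] [Module Rᵐᵒᵖ M] [Module.Finite Rᵐᵒᵖ M]
    [Module.Projective Rᵐᵒᵖ M] [AddCommGroup N] [Module Rᵐᵒᵖ N] [Module.Finite Rᵐᵒᵖ N]
    [Module.Projective Rᵐᵒᵖ N] : (V.mk M + V.mk N : V R) = V.mk (M × N) := rfl

/-- `V R` carries its algebraic preorder: `x ≤ y` if `x + z = y` for some `z`. -/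
instance : LE (V R) where
  le x y := ∃ z : V R, x + z = y

/-- The order unit `[R_R]` of `V R`. -/
instance : One (V R) where
  one := V.mk R

/-- An order-ideal of `V R` is a submonoid that is order-hereditary. -/
def IsOrderIdeal (S : AddSubmonoid (V R)) : Prop :=
  ∀ x y : V R, x ≤ y → y ∈ S → x ∈ S

/-- `S` and `T` are orthogonal order-ideals of `V R`: order-ideals that meet only in `0`. -/
def OrthogonalOrderIdeals (S T : AddSubmonoid (V R)) : Prop :=
  IsOrderIdeal S ∧ IsOrderIdeal T ∧ S ⊓ T = ⊥

variable (R)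

/-- Cancellation of multiples of the order unit, up to complements of a common summand
that lie in orthogonal order-ideals. -/
def UnitCancellation : Prop :=
  ∀ n : ℕ, 1 ≤ n → ∀ b₁ b₂ : V R, n • (1 : V R) + b₁ = n • (1 : V R) + b₂ →
    ∃ S₁ S₂ : AddSubmonoid (V R), OrthogonalOrderIdeals S₁ S₂ ∧
      ∃ x c₁ c₂ : V R, c₁ ∈ S₁ ∧ c₂ ∈ S₂ ∧ b₁ + c₁ = b₂ + c₂ ∧
        x + c₁ = n • (1 : V R) ∧ n • (1 : V R) = x + c₂

/-- Cancellation of arbitrary elements, up to elements of orthogonal order-ideals. -/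
def OrthogonalCancellation : Prop :=
  ∀ a b₁ b₂ : V R, a + b₁ = a + b₂ →
    ∃ S₁ S₂ : AddSubmonoid (V R), OrthogonalOrderIdeals S₁ S₂ ∧
      ∃ c₁ c₂ : V R, c₁ ∈ S₁ ∧ c₂ ∈ S₂ ∧ b₁ + c₁ = b₂ + c₂

end VMonoid

end QBRings

/-!
**`QB`-rings cancel.** For a family of ring homomorphisms, call an element *good* if it is von
Neumann regular and its image under every member of the family is left or right invertible
(`IsGood`). Since one of two centrally orthogonal elements lies in any given prime ideal, a
quasi-invertible element is good for the family of quotient maps by the two-sided prime ideals, and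
a `QB`-ring has the lifting property `HasGoodLifts`: if `x a + b = 1`, then some `a + y b` is good.

Unlike the `QB` condition itself, this property visibly passes to matrices
(`HasGoodLifts.matrix_two`, `HasGoodLifts.matrix`). Given a unimodular pair of two by two matrices,
elementary operations make one entry good, say `w` with quasi-inverse `v`. The row `(w, 1 - w v)` is
completed to an invertible matrix, and the remaining entries are corrected twice, once for the
primes modulo which `v w = 1` and once for those modulo which `w v = 1`. The result is regular only
modulo the prime radical; lifting an idempotent through this nil ideal repairs it
(`exists_isGood_of_regular_map`). That matrices over the prime radical are nilpotent, which is what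
makes the lifting possible, is `isNilpotent_of_forall_prime`.

An isomorphism `Rⁿ ⊕ B₁ ≅ Rⁿ ⊕ B₂` gives a unimodular pair of endomorphisms of `Rⁿ`, hence, after
changing the complement of one copy of `Rⁿ`, a good composite `w` of an inclusion and a projection.
Splitting off kernel and cokernel of `w` yields `B₁ ⊕ coker w ≅ B₂ ⊕ ker w`
(`nonempty_equiv_of_quasi_inverse`). Modulo each prime either the kernel or the cokernel vanishes,
and a finitely generated projective module that vanishes modulo all primes is zero, so both generate
orthogonal order-ideals (`orthogonal_supportIdeal`). Cancellation of an arbitrary class `a` follows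
by adding a complement of `a` in some `Rⁿ`.

**Cancellation makes exchange rings `QB`.** In an exchange ring, `x a + b = 1` gives an idempotent
`f ∈ R b` with `1 - f ∈ R a` (`IsExchangeRing.exists_left`), so that `t = a (1 - f)` is a regular
element of `a + R b` with kernel `f R` and some cokernel `g R`. Cancelling `t R` gives
`f R ⊕ B ≅ g R ⊕ D`, with `B` and `D` from orthogonal order-ideals. The diagonal entries of this
isomorphism and of its inverse extend `t` and its quasi-inverse to elements `u` and `u'` such that
`1 - u u'` factors through `B` and `1 - u' u` through `D`. In a semi-primitive exchange ring every
nonzero right ideal contains a nonzero idempotent, so these elements are centrally orthogonal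
(`IsExchangeRing.mul_mul_eq_zero_of_factor`), and `u` is quasi-invertible.
-/

namespace QBRings

/-! ### Good elements and their lifting modulo nil ideals -/

/-- An element with a left inverse or a right inverse. -/
def IsOneSidedUnit {K : Type*} [Ring K] (u : K) : Prop :=
  (∃ z, z * u = 1) ∨ ∃ z, u * z = 1

theorem IsOneSidedUnit.units_mul {K : Type*} [Ring K] {u : K} (g : Kˣ) (hu : IsOneSidedUnit u) :
    IsOneSidedUnit (g * u) := by
  rcases hu with ⟨z, hz⟩ | ⟨z, hz⟩
  · exact .inl ⟨z * ↑g⁻¹, by rw [mul_assoc, Units.inv_mul_cancel_left, hz]⟩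
  · exact .inr ⟨z * ↑g⁻¹, by rw [mul_assoc, ← mul_assoc u, hz, one_mul, Units.mul_inv]⟩

theorem IsOneSidedUnit.mul_units {K : Type*} [Ring K] {u : K} (g : Kˣ) (hu : IsOneSidedUnit u) :
    IsOneSidedUnit (u * g) := by
  rcases hu with ⟨z, hz⟩ | ⟨z, hz⟩
  · exact .inl ⟨↑g⁻¹ * z, by rw [mul_assoc, ← mul_assoc z, hz, one_mul, Units.inv_mul]⟩
  · exact .inr ⟨↑g⁻¹ * z, by rw [mul_assoc, Units.mul_inv_cancel_left, hz]⟩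

theorem IsOneSidedUnit.mul_eq_one {K : Type*} [Ring K] {u v : K} (hu : IsOneSidedUnit u)
    (h : u * v * u = u) : v * u = 1 ∨ u * v = 1 := by
  rcases hu with ⟨z, hz⟩ | ⟨z, hz⟩
  · left
    calc v * u = (z * u) * (v * u) := by rw [hz, one_mul]
      _ = z * (u * v * u) := by noncomm_ring
      _ = 1 := by rw [h, hz]
  · right
    calc u * v = (u * v) * (u * z) := by rw [hz, mul_one]
      _ = (u * v * u) * z := by noncomm_ring
      _ = 1 := by rw [h, hz]

section Good

variable {S : Type*} [Ring S] {ι : Type*} {K : ι → Type*} [∀ i, Ring (K i)] (φ : ∀ i, S →+* K i)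

/-- A von Neumann regular element whose image under each homomorphism of the family `φ` is left
or right invertible. If `φ` is the family of quotient maps by the prime ideals, the first condition
splits off kernel and cokernel, and the second says that they live over disjoint sets of primes. -/
structure IsGood (u : S) : Prop where
  regular : ∃ v, u * v * u = u
  oneSided : ∀ i, IsOneSidedUnit (φ i u)

/-- The analogue of the `QB` condition with good elements instead of quasi-invertible ones. -/
def HasGoodLifts (S : Type*) [Ring S] {ι : Type*} {K : ι → Type*} [∀ i, Ring (K i)]
    (φ : ∀ i, S →+* K i) : Prop :=
  ∀ x a b : S, x * a + b = 1 → ∃ y, IsGood φ (a + y * b)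

/-- The intersection of the kernels of the family `φ` is a nil ideal. -/
def DetectsNilpotents (S : Type*) [Ring S] {ι : Type*} {K : ι → Type*} [∀ i, Ring (K i)]
    (φ : ∀ i, S →+* K i) : Prop :=
  ∀ s : S, (∀ i, φ i s = 0) → IsNilpotent s

variable {φ}

theorem IsGood.units_mul {u : S} (g : Sˣ) (hu : IsGood φ u) : IsGood φ (g * u) := by
  obtain ⟨v, hv⟩ := hu.regular
  refine ⟨⟨v * ↑g⁻¹, ?_⟩, fun i => ?_⟩
  · calc (g : S) * u * (v * ↑g⁻¹) * (g * u) = g * (u * v * (↑g⁻¹ * g) * u) := by noncomm_ring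
      _ = g * u := by rw [Units.inv_mul, mul_one, hv]
  · rw [map_mul]
    exact (hu.oneSided i).units_mul (Units.map (φ i).toMonoidHom g)

theorem IsGood.mul_units {u : S} (g : Sˣ) (hu : IsGood φ u) : IsGood φ (u * g) := by
  obtain ⟨v, hv⟩ := hu.regular
  refine ⟨⟨↑g⁻¹ * v, ?_⟩, fun i => ?_⟩
  · calc u * g * (↑g⁻¹ * v) * (u * g) = u * (g * ↑g⁻¹) * v * u * g := by noncomm_ring
      _ = u * g := by rw [Units.mul_inv, mul_one, hv]
  · rw [map_mul]
    exact (hu.oneSided i).mul_units (Units.map (φ i).toMonoidHom g)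

theorem IsGood.of_units_mul_mul_units {u : S} (g h : Sˣ) (hu : IsGood φ (g * u * h)) :
    IsGood φ u := by
  simpa [mul_assoc] using (hu.units_mul g⁻¹).mul_units h⁻¹

/-- A good element has a quasi-inverse `v` that is also quasi-inverted by `u`. -/
theorem IsGood.exists_reflexive {u : S} (hu : IsGood φ u) :
    ∃ v, u * v * u = u ∧ v * u * v = v ∧ ∀ i, φ i (v * u) = 1 ∨ φ i (u * v) = 1 := by
  obtain ⟨v, hv⟩ := hu.regular
  have h1 : u * (v * u * v) * u = u := by
    calc u * (v * u * v) * u = (u * v * u) * v * u := by noncomm_ring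
      _ = u := by rw [hv, hv]
  refine ⟨v * u * v, h1, ?_, fun i => ?_⟩
  · calc v * u * v * u * (v * u * v) = v * (u * v * u) * v * u * v := by noncomm_ring
      _ = v * (u * v * u) * v := by nth_rw 1 [hv]; noncomm_ring
      _ = v * u * v := by rw [hv]
  · have := (hu.oneSided i).mul_eq_one (v := φ i (v * u * v)) (by rw [← map_mul, ← map_mul, h1])
    simpa only [map_mul] using this

/-- Lifting of an idempotent modulo a nil ideal, by a polynomial without constant term. -/
theorem exists_idempotent_of_isNilpotent {h : S} (hh : IsNilpotent (h * (1 - h))) :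
    ∃ q : S, IsIdempotentElem (h * q) ∧ Commute h q ∧
      ∀ {T : Type*} [Ring T] (f : S →+* T), IsIdempotentElem (f h) → f (h * q) = f h := by
  obtain ⟨k, hk⟩ := hh
  have hk : (h * (1 - h)) ^ (k + 1) = 0 := by rw [pow_succ, hk, zero_mul]
  open Polynomial in
  let E : ℤ[X] := 1 - (1 - X ^ (k + 1)) ^ (k + 1)
  open Polynomial in
  have h1 : (X : ℤ[X]) ^ (k + 1) ∣ E := by
    simpa using one_sub_dvd_one_sub_pow (1 - (X : ℤ[X]) ^ (k + 1)) (k + 1)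
  open Polynomial in
  have h2 : (1 - X : ℤ[X]) ^ (k + 1) ∣ 1 - E := by
    simpa [E] using pow_dvd_pow_of_dvd (one_sub_dvd_one_sub_pow (X : ℤ[X]) (k + 1)) (k + 1)
  open Polynomial in
  obtain ⟨G, hG⟩ : (X * (1 - X) : ℤ[X]) ^ (k + 1) ∣ E * (1 - E) := by
    rw [mul_pow]; exact mul_dvd_mul h1 h2
  open Polynomial in
  obtain ⟨Q, hQ⟩ : (X : ℤ[X]) ∣ E := (dvd_pow_self X (Nat.succ_ne_zero k)).trans h1
  have hE : h * Polynomial.aeval h Q = 1 - (1 - h ^ (k + 1)) ^ (k + 1) := by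
    have := congrArg (Polynomial.aeval h) hQ
    simpa [E] using this.symm
  refine ⟨Polynomial.aeval h Q, ?_, ?_, ?_⟩
  · have := congrArg (Polynomial.aeval h) hG
    rw [hQ] at this
    simp only [map_mul, map_pow, map_sub, map_one, Polynomial.aeval_X, hk, zero_mul] at this
    rw [mul_sub, mul_one, sub_eq_zero] at this
    exact this.symm
  · have := congrArg (Polynomial.aeval h) (mul_comm Polynomial.X Q)
    simpa [Commute, SemiconjBy] using this
  · intro T _ f hf
    rw [hE, map_sub, map_pow, map_sub, map_pow, map_one, hf.pow_succ_eq, hf.one_sub.pow_succ_eq,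
      sub_sub_cancel]

/-- An element that is regular and one-sidedly invertible only modulo the kernels of the family
can be made good within `t + S b`, when `t` and `b` form a left unimodular pair: `(1 - s t) b` is
idempotent modulo those kernels and annihilated there by `t`; it lifts to an idempotent `e` in `S b`,
and `t (1 - e)` is good. -/
theorem exists_isGood_of_regular_map (hnil : DetectsNilpotents S φ) {x t b s : S}
    (hx : x * t + b = 1) (hone : ∀ i, IsOneSidedUnit (φ i t))
    (hs : ∀ i, φ i (t * s * t) = φ i t) : ∃ y, IsGood φ (t + y * b) := by
  obtain ⟨g, hg⟩ : ∃ g, g = 1 - s * t := ⟨_, rfl⟩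
  obtain ⟨h, hh⟩ : ∃ h, h = g * b := ⟨_, rfl⟩
  obtain ⟨x', hx'⟩ : ∃ x', x' = s + g * x := ⟨_, rfl⟩
  have hb : b = 1 - x * t := eq_sub_of_add_eq' hx
  have hx't : x' * t = 1 - h := by rw [hx', hh, hb, hg]; noncomm_ring
  have htg (i) : φ i t * φ i g = 0 := by
    rw [← map_mul, hg, mul_sub, mul_one, ← mul_assoc, map_sub, hs, sub_self]
  have hth (i) : φ i t * φ i h = 0 := by rw [hh, map_mul, ← mul_assoc, htg, zero_mul]
  have hidem (i) : IsIdempotentElem (φ i h) := by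
    have e1 : φ i h = 1 - φ i x' * φ i t := by rw [← map_mul, hx't]; simp
    change φ i h * φ i h = φ i h
    nth_rw 1 [e1]
    rw [sub_mul, one_mul, mul_assoc, hth, mul_zero, sub_zero]
  have hn : IsNilpotent (h * (1 - h)) := hnil _ fun i => by
    rw [map_mul, map_sub, map_one, mul_sub, mul_one, (hidem i).eq, sub_self]
  obtain ⟨q, heq, hcomm, hmap⟩ := exists_idempotent_of_isNilpotent hn
  obtain ⟨e, he⟩ : ∃ e, e = h * q := ⟨_, rfl⟩
  rw [← he] at heq
  have hφe (i) : φ i e = φ i h := by rw [he]; exact hmap (φ i) (hidem i)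
  have hnn : IsNilpotent ((1 - e) * h * (1 - e)) := hnil _ fun i => by
    rw [map_mul, map_mul, map_sub, map_one, hφe, sub_mul, one_mul, (hidem i).eq, sub_self, zero_mul]
  obtain ⟨z, hz⟩ := hnn.isUnit_one_sub.exists_left_inv
  refine ⟨-t * q * g, ?_⟩
  have ht' : t + -t * q * g * b = t * (1 - e) := by
    rw [he, hcomm.eq, hh]; noncomm_ring
  rw [ht']
  have hs' : (z * (1 - e) * x') * (t * (1 - e)) = 1 - e := by
    have h3 : (1 - e) * (1 - h) * (1 - e) = (1 - (1 - e) * h * (1 - e)) * (1 - e) := by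
      have : (1 - e) * (1 - e) = 1 - e := heq.one_sub.eq
      calc (1 - e) * (1 - h) * (1 - e)
          = (1 - e) * (1 - e) - (1 - e) * h * (1 - e) := by noncomm_ring
        _ = (1 - e) - (1 - e) * h * ((1 - e) * (1 - e)) := by rw [this]
        _ = _ := by noncomm_ring
    calc (z * (1 - e) * x') * (t * (1 - e)) = z * ((1 - e) * (x' * t) * (1 - e)) := by
          noncomm_ring
      _ = 1 - e := by rw [hx't, h3, ← mul_assoc, hz, one_mul]
  refine ⟨⟨z * (1 - e) * x', ?_⟩, fun i => ?_⟩
  · rw [mul_assoc, hs', mul_assoc, heq.one_sub.eq]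
  · have : φ i (t * (1 - e)) = φ i t := by
      rw [map_mul, map_sub, map_one, hφe, mul_sub, mul_one, hth, sub_zero]
    rw [this]
    exact hone i

end Good

/-! ### Passing from a ring to its two by two matrices -/

section Doubling

variable {S : Type*} [Ring S] {ι : Type*} {K : ι → Type*} [∀ i, Ring (K i)] {φ : ∀ i, S →+* K i}

/-- To find a good element in `a + S b` for a left unimodular pair `a, b`, the element `a` may first
be replaced by any `g (a + y b) h` with units `g` and `h`. -/
theorem exists_isGood_of_units {x a b : S} (hx : x * a + b = 1) (g h : Sˣ) (y : S)
    (H : ∀ x' b', x' * (g * (a + y * b) * h) + b' = 1 →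
      ∃ y', IsGood φ (g * (a + y * b) * h + y' * b')) :
    ∃ y, IsGood φ (a + y * b) := by
  obtain ⟨y', hy'⟩ := H (↑h⁻¹ * x * ↑g⁻¹) (↑h⁻¹ * ((1 - x * y) * b) * h) (by
    calc (↑h⁻¹ * x * ↑g⁻¹ : S) * (g * (a + y * b) * h) + ↑h⁻¹ * ((1 - x * y) * b) * h
        = ↑h⁻¹ * (x * (↑g⁻¹ * g) * (a + y * b) + (1 - x * y) * b) * h := by noncomm_ring
      _ = ↑h⁻¹ * (x * a + b) * h := by rw [Units.inv_mul]; noncomm_ring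
      _ = 1 := by rw [hx, mul_one, Units.inv_mul])
  refine ⟨y + ↑g⁻¹ * y' * ↑h⁻¹ * (1 - x * y), IsGood.of_units_mul_mul_units g h ?_⟩
  convert hy' using 1
  calc (g : S) * (a + (y + ↑g⁻¹ * y' * ↑h⁻¹ * (1 - x * y)) * b) * h
      = g * (a + y * b) * h + (g * ↑g⁻¹) * y' * (↑h⁻¹ * ((1 - x * y) * b) * h) := by noncomm_ring
    _ = _ := by rw [Units.mul_inv, one_mul]

/-- The lower triangular transvection of size two. -/
def lowerUnit (k : S) : (Matrix (Fin 2) (Fin 2) S)ˣ where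
  val := !![1, 0; k, 1]
  inv := !![1, 0; -k, 1]
  val_inv := by simp [Matrix.one_fin_two]
  inv_val := by simp [Matrix.one_fin_two]

/-- The upper triangular transvection of size two. -/
def upperUnit (k : S) : (Matrix (Fin 2) (Fin 2) S)ˣ where
  val := !![1, k; 0, 1]
  inv := !![1, -k; 0, 1]
  val_inv := by simp [Matrix.one_fin_two]
  inv_val := by simp [Matrix.one_fin_two]

/-- The permutation matrix of size two. -/
def swapUnit : (Matrix (Fin 2) (Fin 2) S)ˣ where
  val := !![0, 1; 1, 0]
  inv := !![0, 1; 1, 0]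
  val_inv := by simp [Matrix.one_fin_two]
  inv_val := by simp [Matrix.one_fin_two]

/-- The invertible completion of the row `(w, 1 - w v)`, for mutually quasi-inverse `v` and `w`. -/
def quasiUnit {w v : S} (h1 : w * v * w = w) (h2 : v * w * v = v) :
    (Matrix (Fin 2) (Fin 2) S)ˣ where
  val := !![w, 1 - w * v; 1 - v * w, v]
  inv := !![v, 1 - v * w; 1 - w * v, w]
  val_inv := by
    simp only [Matrix.mul_fin_two, Matrix.one_fin_two, mul_sub, sub_mul, mul_one, one_mul,
      ← mul_assoc, h1, h2, sub_self, add_zero]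
    simp
  inv_val := by
    simp only [Matrix.mul_fin_two, Matrix.one_fin_two, mul_sub, sub_mul, mul_one, one_mul,
      ← mul_assoc, h1, h2, sub_self, add_zero]
    simp

/-- A row operation and a modification by `b` that change only the second row of `a` make the
lower right entry good. -/
theorem exists_isGood_corner (H : HasGoodLifts S φ) {x a b : Matrix (Fin 2) (Fin 2) S}
    (hx : x * a + b = 1) :
    ∃ (g : (Matrix (Fin 2) (Fin 2) S)ˣ) (y : Matrix (Fin 2) (Fin 2) S),
      (g * (a + y * b)) 0 0 = a 0 0 ∧ (g * (a + y * b)) 0 1 = a 0 1 ∧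
        IsGood φ ((g * (a + y * b)) 1 1) := by
  have h11 : x 1 1 * a 1 1 + (x 1 0 * a 0 1 + b 1 1) = 1 := by
    have := congrFun (congrFun hx 1) 1
    simp only [Matrix.add_apply, Matrix.mul_apply, Fin.sum_univ_two, Matrix.one_apply_eq] at this
    rw [← this]; abel
  obtain ⟨ζ, hζ⟩ := H _ _ _ h11
  refine ⟨lowerUnit (ζ * x 1 0), !![0, 0; 0, ζ], ?_, ?_, ?_⟩
  · simp [lowerUnit, Matrix.mul_apply, Matrix.vecMul, dotProduct, Fin.sum_univ_two]
  · simp [lowerUnit, Matrix.mul_apply, Matrix.vecMul, dotProduct, Fin.sum_univ_two]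
  · convert hζ using 1
    simp [lowerUnit, Matrix.mul_apply, Matrix.vecMul, dotProduct, Fin.sum_univ_two]
    noncomm_ring

/-- If `T` is one-sidedly invertible with one-sided inverse `V`, then so is `T + y (1 - V T) b`, for
any `y`, as soon as `T` and `b` form a left unimodular pair. -/
theorem mul_eq_one_or_of_quasi {K : Type*} [Ring K] {X T b V : K} (y : K) (hX : X * T + b = 1)
    (h : T * V = 1 ∨ V * T = 1) :
    (T + y * ((1 - V * T) * b)) * (V + (1 - V * T) * X) = 1 ∨
      (V + (1 - V * T) * X) * (T + y * ((1 - V * T) * b)) = 1 := by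
  rcases h with h | h
  · left
    have hb : b = 1 - X * T := eq_sub_of_add_eq' hX
    have hV : (1 - V * T) * V = 0 := by rw [sub_mul, mul_assoc, h]; simp
    have hT : T * (1 - V * T) = 0 := by rw [mul_sub, ← mul_assoc, h]; simp
    have hf : (1 - V * T) * (1 - V * T) = 1 - V * T := by
      rw [sub_mul (1 : K), mul_assoc V, hT]; simp
    obtain ⟨f, hf'⟩ : ∃ f, f = 1 - V * T := ⟨_, rfl⟩
    rw [← hf'] at hV hT hf ⊢
    calc (T + y * (f * b)) * (V + f * X)
        = T * V + T * f * X + y * (f * V + f * f * X - f * X * (T * V) - f * X * (T * f) * X) := by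
          rw [hb]; noncomm_ring
      _ = 1 := by rw [h, hT, hV, hf]; simp
  · right
    rw [h]; simpa using h

theorem mul_mul_eq_of_eq_one_or {K : Type*} [Ring K] {T s : K} (h : T * s = 1 ∨ s * T = 1) :
    T * s * T = T := by
  rcases h with h | h
  · rw [h, one_mul]
  · rw [mul_assoc, h, mul_one]

theorem isOneSidedUnit_of_eq_one_or {K : Type*} [Ring K] {T s : K} (h : T * s = 1 ∨ s * T = 1) :
    IsOneSidedUnit T :=
  h.symm.imp (fun h => ⟨s, h⟩) fun h => ⟨s, h⟩

/-- A matrix `!![1, 0; c, w]` is invertible on the side on which `w` is. -/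
theorem lower_eq_one_or {K : Type*} [Ring K] {c w v : K} (h : v * w = 1 ∨ w * v = 1) :
    !![1, 0; c, w] * !![1, 0; -(v * c), v] = 1 ∨ !![1, 0; -(v * c), v] * !![1, 0; c, w] = 1 := by
  rcases h with h | h
  · right; simp [Matrix.one_fin_two, h]
  · left; simp [Matrix.one_fin_two, h, ← mul_assoc]

/-- The last correction: a matrix `T` which under each homomorphism either has the one-sided inverse
`V` or has first row `(1, 0)`. Making the lower right entry good by a modification that is a
multiple of `(1 - V T) b` settles the second kind of homomorphisms without losing the one-sided inverses for the first. -/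
theorem exists_isGood_of_quasi (H : HasGoodLifts S φ)
    (hnil : DetectsNilpotents (Matrix (Fin 2) (Fin 2) S) fun i => (φ i).mapMatrix)
    {X T b V : Matrix (Fin 2) (Fin 2) S} (hX : X * T + b = 1)
    (hV : ∀ i, ((φ i).mapMatrix T * (φ i).mapMatrix V = 1 ∨
      (φ i).mapMatrix V * (φ i).mapMatrix T = 1) ∨ (φ i (T 0 0) = 1 ∧ φ i (T 0 1) = 0)) :
    ∃ y, IsGood (fun i => (φ i).mapMatrix) (T + y * b) := by
  obtain ⟨f, hf⟩ : ∃ f, f = 1 - V * T := ⟨_, rfl⟩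
  have hX' : (V + f * X) * T + f * b = 1 := by
    calc (V + f * X) * T + f * b = V * T + f * (X * T + b) := by noncomm_ring
      _ = 1 := by rw [hX, hf]; noncomm_ring
  obtain ⟨g, y, h00, h01, hgood⟩ := exists_isGood_corner H hX'
  refine exists_isGood_of_units hX g 1 (y * f) fun X3 b3 hX3 => ?_
  rw [Units.val_one, mul_one, mul_assoc y] at hX3 ⊢
  obtain ⟨T3, hT3⟩ : ∃ T3, T3 = (g : Matrix (Fin 2) (Fin 2) S) * (T + y * (f * b)) := ⟨_, rfl⟩
  rw [← hT3] at hX3 h00 h01 hgood ⊢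
  obtain ⟨v, -, -, hv⟩ := hgood.exists_reflexive
  obtain ⟨s₁, hs₁⟩ : ∃ s₁, s₁ = (V + f * X) * g⁻¹.val := ⟨_, rfl⟩
  obtain ⟨s₂, hs₂⟩ : ∃ s₂, s₂ = !![1, 0; -(v * T3 1 0), v] := ⟨_, rfl⟩
  have key (i) : ((φ i).mapMatrix T3 * (φ i).mapMatrix s₁ = 1 ∨
      (φ i).mapMatrix s₁ * (φ i).mapMatrix T3 = 1) ∨ ((φ i).mapMatrix T3 * (φ i).mapMatrix s₂ = 1 ∨
      (φ i).mapMatrix s₂ * (φ i).mapMatrix T3 = 1) := by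
    rcases hV i with h | ⟨h0, h1⟩
    · left
      have := mul_eq_one_or_of_quasi ((φ i).mapMatrix y)
        (by rw [← map_mul, ← map_add, hX, map_one]) h
      rw [← map_mul, ← map_one (φ i).mapMatrix, ← map_sub, ← map_mul, ← map_mul, ← map_mul,
        ← map_add, ← map_add, ← map_mul, ← map_mul, ← hf] at this
      rw [← map_mul, ← map_mul, ← map_one (φ i).mapMatrix]
      refine this.imp (fun h => ?_) fun h => ?_
      · have e : T3 * s₁ = g * ((T + y * (f * b)) * (V + f * X)) * g⁻¹.val := by
          rw [hT3, hs₁]; noncomm_ring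
        rw [e, map_mul, map_mul, h, map_one, mul_one, ← map_mul, Units.mul_inv, map_one]
      · have e : s₁ * T3 = (V + f * X) * (T + y * (f * b)) := by
          rw [hT3, hs₁, mul_assoc, Units.inv_mul_cancel_left]
        rw [e, h]
    · right
      have e : (φ i).mapMatrix T3 = !![1, 0; φ i (T3 1 0), φ i (T3 1 1)] := by
        ext j k
        fin_cases j <;> fin_cases k <;> simp [h00, h01, h0, h1]
      have e' : (φ i).mapMatrix s₂ = !![1, 0; -(φ i v * φ i (T3 1 0)), φ i v] := by
        ext j k
        fin_cases j <;> fin_cases k <;> simp [hs₂]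
      rw [e, e']
      exact lower_eq_one_or (by simpa only [map_mul] using hv i)
  -- under each homomorphism `s₁` or `s₂` is a quasi-inverse of `T3`, hence so is their circle
  -- composition
  refine exists_isGood_of_regular_map hnil hX3 (s := s₁ + s₂ - s₁ * T3 * s₂)
    (fun i => (key i).elim isOneSidedUnit_of_eq_one_or isOneSidedUnit_of_eq_one_or) fun i => ?_
  rcases key i with h | h
  · have h := mul_mul_eq_of_eq_one_or h
    rw [← map_mul, ← map_mul] at h
    calc (φ i).mapMatrix (T3 * (s₁ + s₂ - s₁ * T3 * s₂) * T3)
        = (φ i).mapMatrix (T3 * s₁ * T3 + T3 * s₂ * T3 - (T3 * s₁ * T3) * (s₂ * T3)) := by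
          congr 1; noncomm_ring
      _ = _ := by rw [map_sub, map_add, map_mul _ (T3 * s₁ * T3), h, ← map_mul, ← mul_assoc,
          add_sub_cancel_right]
  · have h := mul_mul_eq_of_eq_one_or h
    rw [← map_mul, ← map_mul] at h
    calc (φ i).mapMatrix (T3 * (s₁ + s₂ - s₁ * T3 * s₂) * T3)
        = (φ i).mapMatrix (T3 * s₁ * T3 + T3 * s₂ * T3 - (T3 * s₁) * (T3 * s₂ * T3)) := by
          congr 1; noncomm_ring
      _ = _ := by rw [map_sub, map_add, map_mul _ (T3 * s₁) (T3 * s₂ * T3), h, ← map_mul,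
          add_sub_cancel_left]

/-- The case of a good upper left entry `w` with quasi-inverse `v` annihilating the entry next to
it. Multiplication by `quasiUnit⁻¹` turns the first row into `(1, 0)` under the homomorphisms with
`v w = 1`; conjugating back after the second row has been corrected gives the first row `(1, 0)`
under the homomorphisms with `w v = 1`. -/
theorem exists_isGood_of_entry (H : HasGoodLifts S φ)
    (hnil : DetectsNilpotents (Matrix (Fin 2) (Fin 2) S) fun i => (φ i).mapMatrix)
    {X T b : Matrix (Fin 2) (Fin 2) S} (hX : X * T + b = 1) {v : S}
    (h1 : T 0 0 * v * T 0 0 = T 0 0) (h2 : v * T 0 0 * v = v)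
    (hv : ∀ i, φ i (v * T 0 0) = 1 ∨ φ i (T 0 0 * v) = 1) (hβ : v * T 0 1 = 0) :
    ∃ y, IsGood (fun i => (φ i).mapMatrix) (T + y * b) := by
  obtain ⟨w, hw⟩ : ∃ w, w = T 0 0 := ⟨_, rfl⟩
  rw [← hw] at h1 h2 hv
  let U := quasiUnit h1 h2
  have hU : (U : Matrix (Fin 2) (Fin 2) S) = !![w, 1 - w * v; 1 - v * w, v] := rfl
  have hU' : (U⁻¹.val : Matrix (Fin 2) (Fin 2) S) = !![v, 1 - v * w; 1 - w * v, w] := rfl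
  have hX' : (X * U.val) * (U⁻¹.val * T) + b = 1 := by
    rw [mul_assoc, Units.mul_inv_cancel_left, hX]
  obtain ⟨g, y, h00, h01, hgood⟩ := exists_isGood_corner H hX'
  refine exists_isGood_of_units hX (U * g * U⁻¹) U⁻¹ (U.val * y) fun X2 b2 hX2 => ?_
  obtain ⟨T1, hT1⟩ : ∃ T1, T1 = (g : Matrix (Fin 2) (Fin 2) S) * (U⁻¹.val * T + y * b) := ⟨_, rfl⟩
  rw [← hT1] at h00 h01 hgood
  have hT2 : (U * g * U⁻¹).val * (T + U.val * y * b) * U⁻¹.val =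
      U.val * T1 * U⁻¹.val := by
    rw [hT1, Units.val_mul, Units.val_mul]
    calc U.val * g.val * U⁻¹.val * (T + U.val * y * b) * U⁻¹.val
        = U.val * (g * (U⁻¹.val * T + (U⁻¹.val * U.val) * y * b)) * U⁻¹.val := by noncomm_ring
      _ = _ := by rw [Units.inv_mul, one_mul]
  rw [hT2] at hX2 ⊢
  obtain ⟨v', -, -, hv'⟩ := hgood.exists_reflexive
  have e00 : T1 0 0 = v * w + (1 - v * w) * T 1 0 := by
    rw [h00, hU', hw]; simp [Matrix.mul_apply, Fin.sum_univ_two]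
  have e01 : T1 0 1 = (1 - v * w) * T 1 1 := by
    rw [h01, hU']; simp [Matrix.mul_apply, Fin.sum_univ_two, hβ]
  refine exists_isGood_of_quasi H hnil (V := U.val * !![1, 0; -(v' * T1 1 0), v'] * U⁻¹.val) hX2
    fun i => ?_
  rcases hv i with h | h
  · left
    have e : (φ i).mapMatrix T1 = !![1, 0; φ i (T1 1 0), φ i (T1 1 1)] := by
      ext j k
      fin_cases j <;> fin_cases k <;> simp [e00, e01, h, -map_mul, map_mul _ (1 - v * w)]
    have e' : (φ i).mapMatrix !![1, 0; -(v' * T1 1 0), v'] =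
        !![1, 0; -(φ i v' * φ i (T1 1 0)), φ i v'] := by
      ext j k
      fin_cases j <;> fin_cases k <;> simp
    have := lower_eq_one_or (c := φ i (T1 1 0)) (w := φ i (T1 1 1)) (v := φ i v')
      (by simpa only [map_mul] using hv' i)
    rw [← e, ← e', ← map_mul, ← map_mul] at this
    rw [← map_mul, ← map_mul]
    refine this.imp (fun h => ?_) fun h => ?_
    · have : (U.val * T1 * U⁻¹.val : Matrix (Fin 2) (Fin 2) S) *
          (U.val * !![1, 0; -(v' * T1 1 0), v'] * U⁻¹.val) =
          U.val * (T1 * !![1, 0; -(v' * T1 1 0), v']) * U⁻¹.val := by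
        simp only [mul_assoc, Units.inv_mul_cancel_left]
      rw [this, map_mul, map_mul, h, mul_one, ← map_mul, Units.mul_inv, map_one]
    · have : (U.val * !![1, 0; -(v' * T1 1 0), v'] * U⁻¹.val) *
          (U.val * T1 * U⁻¹.val : Matrix (Fin 2) (Fin 2) S) =
          U.val * (!![1, 0; -(v' * T1 1 0), v'] * T1) * U⁻¹.val := by
        simp only [mul_assoc, Units.inv_mul_cancel_left]
      rw [this, map_mul, map_mul, h, mul_one, ← map_mul, Units.mul_inv, map_one]
  · right
    have hwv : φ i w * φ i v = 1 := by rw [← map_mul, h]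
    have hw0 : φ i w * (1 - φ i v * φ i w) = 0 := by
      rw [mul_sub, ← mul_assoc, hwv]; simp
    have hw0' (z : K i) : φ i w * ((1 - φ i v * φ i w) * z) = 0 := by
      rw [← mul_assoc, hw0, zero_mul]
    have hwv' (z : K i) : φ i w * (φ i v * z) = z := by rw [← mul_assoc, hwv, one_mul]
    constructor
    · simp [hU, hU', Matrix.mul_apply, Matrix.vecMul, dotProduct, Fin.sum_univ_two, e00, e01,
        mul_add, add_mul, hw0', hwv, mul_assoc]
    · simp [hU, hU', Matrix.mul_apply, Matrix.vecMul, dotProduct, Fin.sum_univ_two, e00, e01,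
        mul_add, add_mul, hw0', hwv, hw0, mul_assoc]

/-- Two by two matrices inherit the lifting property for good elements. -/
theorem HasGoodLifts.matrix_two (H : HasGoodLifts S φ)
    (hnil : DetectsNilpotents (Matrix (Fin 2) (Fin 2) S) fun i => (φ i).mapMatrix) :
    HasGoodLifts (Matrix (Fin 2) (Fin 2) S) fun i => (φ i).mapMatrix := by
  intro x a b hx
  obtain ⟨g, y, -, -, hgood⟩ := exists_isGood_corner H hx
  obtain ⟨v, h1, h2, hv⟩ := hgood.exists_reflexive
  obtain ⟨T, hT⟩ : ∃ T, T = (g : Matrix (Fin 2) (Fin 2) S) * (a + y * b) := ⟨_, rfl⟩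
  rw [← hT] at h1 hgood h2 hv
  refine exists_isGood_of_units hx (swapUnit * g) (swapUnit * upperUnit (-(v * T 1 0))) y
    fun X b' hX => ?_
  have hT' : (swapUnit * g).val *
      (a + y * b) * (swapUnit * upperUnit (-(v * T 1 0))).val =
      !![T 1 1, T 1 0 - T 1 1 * (v * T 1 0); T 0 1, T 0 0 - T 0 1 * (v * T 1 0)] := by
    rw [Units.val_mul, mul_assoc (swapUnit : (Matrix (Fin 2) (Fin 2) S)ˣ).val, ← hT, Units.val_mul]
    ext j k
    fin_cases j <;> fin_cases k <;>
      simp [swapUnit, upperUnit, Matrix.mul_apply, Matrix.vecMul, dotProduct, Fin.sum_univ_two,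
        sub_eq_add_neg]
  rw [hT'] at hX ⊢
  refine exists_isGood_of_entry H hnil hX (v := v) (by simpa using h1) (by simpa using h2)
    (by simpa using hv) ?_
  simp [mul_sub, ← mul_assoc, h2]

end Doubling

/-! ### Matrices of arbitrary size -/

section Transport

variable {S : Type*} [Ring S] {S' : Type*} [Ring S'] {ι : Type*} {K : ι → Type*}
  [∀ i, Ring (K i)] {φ : ∀ i, S →+* K i} {K' : ι → Type*} [∀ i, Ring (K' i)]
  {φ' : ∀ i, S' →+* K' i}

theorem HasGoodLifts.of_ringEquiv (H : HasGoodLifts S φ) (e : S ≃+* S')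
    (f : ∀ i, K i ≃+* K' i) (hf : ∀ i s, φ' i (e s) = f i (φ i s)) : HasGoodLifts S' φ' := by
  intro x a b hx
  obtain ⟨y, ⟨v, hv⟩, hy⟩ := H (e.symm x) (e.symm a) (e.symm b) (by
    rw [← map_mul, ← map_add, hx, map_one])
  have hu : e (e.symm a + y * e.symm b) = a + e y * b := by simp
  refine ⟨e y, ⟨e v, ?_⟩, fun i => ?_⟩
  · rw [← hu, ← map_mul, ← map_mul, hv]
  · rw [← hu, hf]
    exact (hy i).imp (fun ⟨z, hz⟩ => ⟨f i z, by rw [← map_mul, hz, map_one]⟩)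
      fun ⟨z, hz⟩ => ⟨f i z, by rw [← map_mul, hz, map_one]⟩

variable {α β : Type*} [Fintype α] [DecidableEq α] [Fintype β] [DecidableEq β]

/-- The lifting property passes to the upper left corner of a matrix ring: apply it to the pair
`diag(a, 1)`, `diag(b, 0)`. -/
theorem HasGoodLifts.corner
    (H : HasGoodLifts (Matrix (α ⊕ β) (α ⊕ β) S) fun i => (φ i).mapMatrix) :
    HasGoodLifts (Matrix α α S) fun i => (φ i).mapMatrix := by
  intro x a b hx
  obtain ⟨y, hy⟩ := H (.fromBlocks x 0 0 1) (.fromBlocks a 0 0 1) (.fromBlocks b 0 0 0) (by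
    simp [Matrix.fromBlocks_multiply, Matrix.fromBlocks_add, hx])
  let g : (Matrix (α ⊕ β) (α ⊕ β) S)ˣ :=
    { val := .fromBlocks 1 0 (-(y.toBlocks₂₁ * b)) 1
      inv := .fromBlocks 1 0 (y.toBlocks₂₁ * b) 1
      val_inv := by simp [Matrix.fromBlocks_multiply]
      inv_val := by simp [Matrix.fromBlocks_multiply] }
  have hg : (.fromBlocks a 0 0 1 + y * .fromBlocks b 0 0 0) * g.val =
      .fromBlocks (a + y.toBlocks₁₁ * b) 0 0 1 := by
    change _ * Matrix.fromBlocks 1 0 (-(y.toBlocks₂₁ * b)) 1 = _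
    nth_rw 1 [← Matrix.fromBlocks_toBlocks y]
    simp [Matrix.fromBlocks_multiply, Matrix.fromBlocks_add]
  have hgood := hy.mul_units g
  rw [hg] at hgood
  refine ⟨y.toBlocks₁₁, ?_, fun i => ?_⟩
  · obtain ⟨v, hv⟩ := hgood.regular
    refine ⟨v.toBlocks₁₁, ?_⟩
    rw [← Matrix.fromBlocks_toBlocks v] at hv
    simp only [Matrix.fromBlocks_multiply, Matrix.fromBlocks_inj] at hv
    simpa using hv.1
  · have := hgood.oneSided i
    rw [RingHom.mapMatrix_apply, Matrix.fromBlocks_map] at this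
    refine this.imp (fun ⟨z, hz⟩ => ⟨z.toBlocks₁₁, ?_⟩) fun ⟨z, hz⟩ => ⟨z.toBlocks₁₁, ?_⟩ <;>
    · rw [← Matrix.fromBlocks_toBlocks z, Matrix.fromBlocks_multiply, ← Matrix.fromBlocks_one,
        Matrix.fromBlocks_inj] at hz
      simpa using hz.1

theorem HasGoodLifts.reindex (e : α ≃ β)
    (H : HasGoodLifts (Matrix α α S) fun i => (φ i).mapMatrix) :
    HasGoodLifts (Matrix β β S) fun i => (φ i).mapMatrix :=
  H.of_ringEquiv (Matrix.reindexRingEquiv S e) (fun i => Matrix.reindexRingEquiv (K i) e)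
    fun _ _ => rfl

/-- If nilpotence is detected for matrices of every size, then the lifting property passes to
matrices whose size is a power of two, by repeated doubling. -/
theorem HasGoodLifts.matrix_two_pow (H : HasGoodLifts S φ)
    (hnil : ∀ n : ℕ, DetectsNilpotents (Matrix (Fin n) (Fin n) S) fun i => (φ i).mapMatrix)
    (k : ℕ) :
    HasGoodLifts (Matrix (Fin (2 ^ k)) (Fin (2 ^ k)) S) fun i => (φ i).mapMatrix := by
  induction k with
  | zero =>
    have : HasGoodLifts (Matrix (Fin 1) (Fin 1) S) fun i => (φ i).mapMatrix :=
      H.of_ringEquiv Matrix.uniqueRingEquiv.symm (fun i => Matrix.uniqueRingEquiv.symm)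
        fun _ _ => by ext; rfl
    exact this
  | succ k ih =>
    have e : Fin 2 × Fin (2 ^ k) ≃ Fin (2 ^ (k + 1)) :=
      Fintype.equivOfCardEq (by simp [pow_succ, mul_comm])
    refine HasGoodLifts.reindex e ?_
    refine (HasGoodLifts.matrix_two ih ?_).of_ringEquiv (Matrix.compRingEquiv _ _ _)
      (fun i => Matrix.compRingEquiv _ _ _) fun _ _ => rfl
    intro s hs
    have h := hnil _ ((Matrix.reindexRingEquiv S e) (Matrix.compRingEquiv _ _ _ s)) fun i => ?_
    · exact (IsNilpotent.map_iff (Matrix.compRingEquiv _ _ _).injective).1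
        ((IsNilpotent.map_iff (Matrix.reindexRingEquiv S e).injective).1 h)
    · ext j k
      exact congrFun (congrFun (congrFun (congrFun (hs i) (e.symm j).1) (e.symm k).1)
        (e.symm j).2) (e.symm k).2

theorem HasGoodLifts.matrix (H : HasGoodLifts S φ)
    (hnil : ∀ n : ℕ, DetectsNilpotents (Matrix (Fin n) (Fin n) S) fun i => (φ i).mapMatrix)
    (n : ℕ) :
    HasGoodLifts (Matrix (Fin n) (Fin n) S) fun i => (φ i).mapMatrix := by
  have e : Fin (2 ^ n) ≃ Fin n ⊕ Fin (2 ^ n - n) :=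
    Fintype.equivOfCardEq (by simp [Nat.add_sub_cancel' n.lt_two_pow_self.le])
  exact ((H.matrix_two_pow hnil n).reindex e).corner

end Transport

/-! ### Prime ideals and the prime radical -/

section Prime

variable {R : Type u} [Ring R]

/-- Prime two-sided ideals of a noncommutative ring. The whole ring is allowed, which is harmless:
every condition that is imposed modulo a prime ideal holds trivially modulo the whole ring. -/
def IsPrimeTwoSided (Q : TwoSidedIdeal R) : Prop :=
  ∀ a b : R, (∀ r, a * r * b ∈ Q) → a ∈ Q ∨ b ∈ Q

variable (R) in
/-- The prime two-sided ideals of `R`. -/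
abbrev PrimeIdeals : Type u := {Q : TwoSidedIdeal R // IsPrimeTwoSided Q}

/-- The quotient map by a prime two-sided ideal. -/
def primeQuotient (Q : PrimeIdeals R) : R →+* Q.1.ringCon.Quotient := Q.1.ringCon.mk'

theorem primeQuotient_eq_zero (Q : PrimeIdeals R) {r : R} : primeQuotient Q r = 0 ↔ r ∈ Q.1 := by
  rw [← TwoSidedIdeal.mem_ker]
  exact iff_of_eq (congrArg (r ∈ ·) (TwoSidedIdeal.ker_ringCon_mk' Q.1))

/-- A matrix with all entries in the prime radical is nilpotent. An ideal that is maximal among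
those that contain the entries of no power of `A` is prime. -/
theorem isNilpotent_of_forall_prime {n : ℕ} (A : Matrix (Fin n) (Fin n) R)
    (hA : ∀ Q : PrimeIdeals R, ∀ i j, A i j ∈ Q.1) : IsNilpotent A := by
  by_contra hn
  obtain ⟨Q, hQ⟩ : ∃ Q : TwoSidedIdeal R,
      Maximal (fun Q : TwoSidedIdeal R => ∀ k, ¬ ∀ i j, (A ^ k) i j ∈ Q) Q := by
    refine zorn_le₀ {Q : TwoSidedIdeal R | ∀ k, ¬ ∀ i j, (A ^ k) i j ∈ Q} fun c hc hchain => ?_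
    rcases c.eq_empty_or_nonempty with rfl | hne
    · refine ⟨⊥, fun k hk => hn ⟨k, ?_⟩, by simp⟩
      ext i j
      simpa using hk i j
    have hdir : DirectedOn (· ≤ ·) c := hchain.directedOn
    let U : TwoSidedIdeal R := .mk' {x | ∃ Q ∈ c, x ∈ Q}
      (by obtain ⟨Q, hQ⟩ := hne; exact ⟨Q, hQ, Q.zero_mem⟩)
      (by
        rintro x y ⟨Q, hQ, hx⟩ ⟨Q', hQ', hy⟩
        obtain ⟨Q'', hQ'', h1, h2⟩ := hdir Q hQ Q' hQ'
        exact ⟨Q'', hQ'', Q''.add_mem (h1 hx) (h2 hy)⟩)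
      (by rintro x ⟨Q, hQ, hx⟩; exact ⟨Q, hQ, Q.neg_mem hx⟩)
      (by rintro x y ⟨Q, hQ, hy⟩; exact ⟨Q, hQ, Q.mul_mem_left x y hy⟩)
      (by rintro x y ⟨Q, hQ, hx⟩; exact ⟨Q, hQ, Q.mul_mem_right x y hx⟩)
    have hU (x : R) : x ∈ U ↔ ∃ Q ∈ c, x ∈ Q := by
      simp only [U, TwoSidedIdeal.mem_mk', Set.mem_ofPred_eq]
    refine ⟨U, fun k hk => ?_, fun Q hQ x hx => (hU x).2 ⟨Q, hQ, hx⟩⟩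
    -- finitely many entries lie in a single member of the chain
    have : ∀ s : Finset (Fin n × Fin n), ∃ Q ∈ c, ∀ p ∈ s, (A ^ k) p.1 p.2 ∈ Q := by
      intro s
      induction s using Finset.induction_on with
      | empty => obtain ⟨Q, hQ⟩ := hne; exact ⟨Q, hQ, by simp⟩
      | insert p s _ ih =>
        obtain ⟨Q, hQ, h1⟩ := ih
        obtain ⟨Q', hQ', h2⟩ := (hU _).1 (hk p.1 p.2)
        obtain ⟨Q'', hQ'', h3, h4⟩ := hdir Q hQ Q' hQ'
        refine ⟨Q'', hQ'', fun q hq => ?_⟩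
        rcases Finset.mem_insert.1 hq with rfl | hq
        · exact h4 h2
        · exact h3 (h1 q hq)
    obtain ⟨Q, hQ, h⟩ := this Finset.univ
    exact hc hQ k fun i j => h (i, j) (Finset.mem_univ _)
  have hlarger {I : TwoSidedIdeal R} (hI : Q ≤ I) {a : R} (ha : a ∉ Q) (haI : a ∈ I) :
      ∃ k, ∀ i j, (A ^ k) i j ∈ I := by
    by_contra! h
    exact ha (hQ.le_of_ge (y := I) (fun k hk => by obtain ⟨i, j, hij⟩ := h k; exact hij (hk i j)) hI
      haI)
  have hprime : IsPrimeTwoSided Q := by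
    intro a b hab
    by_contra! h
    let I : TwoSidedIdeal R := .mk' {x | ∀ r, x * r * b ∈ Q}
      (fun r => by simp)
      (fun hx hy r => by rw [add_mul, add_mul]; exact Q.add_mem (hx r) (hy r))
      (fun hx r => by rw [neg_mul, neg_mul]; exact Q.neg_mem (hx r))
      (fun {x y} hy r => by rw [mul_assoc x, mul_assoc x]; exact Q.mul_mem_left _ _ (hy r))
      (fun {x y} hx r => by rw [mul_assoc x]; exact hx _)
    have hI (x : R) : x ∈ I ↔ ∀ r, x * r * b ∈ Q := by
      simp only [I, TwoSidedIdeal.mem_mk', Set.mem_ofPred_eq]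
    let J : TwoSidedIdeal R := .mk' {y | ∀ x ∈ I, ∀ r, x * r * y ∈ Q}
      (fun x _ r => by simp)
      (fun hx hy z hz r => by rw [mul_add]; exact Q.add_mem (hx z hz r) (hy z hz r))
      (fun hx z hz r => by rw [mul_neg]; exact Q.neg_mem (hx z hz r))
      (fun {x y} hy z hz r => by rw [← mul_assoc, mul_assoc z]; exact hy z hz _)
      (fun {x y} hx z hz r => by rw [← mul_assoc]; exact Q.mul_mem_right _ _ (hx z hz r))
    have hJ (y : R) : y ∈ J ↔ ∀ x ∈ I, ∀ r, x * r * y ∈ Q := by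
      simp only [J, TwoSidedIdeal.mem_mk', Set.mem_ofPred_eq]
    obtain ⟨k, hk⟩ := hlarger (I := I) (fun x hx => (hI x).2 fun r =>
      Q.mul_mem_right _ _ (Q.mul_mem_right _ _ hx)) h.1 ((hI a).2 hab)
    obtain ⟨l, hl⟩ := hlarger (I := J) (fun y hy => (hJ y).2 fun x _ r =>
      Q.mul_mem_left _ _ hy) h.2 ((hJ b).2 fun x hx => (hI x).1 hx)
    refine hQ.prop (k + l) fun i j => ?_
    rw [pow_add, Matrix.mul_apply]
    refine sum_mem fun m _ => ?_
    simpa using (hJ _).1 (hl m j) _ (hk i m) 1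
  exact hQ.prop 1 fun i j => by rw [pow_one]; exact hA ⟨Q, hprime⟩ i j

theorem detectsNilpotents_matrix (n : ℕ) :
    DetectsNilpotents (Matrix (Fin n) (Fin n) R) fun Q : PrimeIdeals R =>
      (primeQuotient Q).mapMatrix := by
  intro A hA
  refine isNilpotent_of_forall_prime A fun Q i j => ?_
  exact (primeQuotient_eq_zero Q).1 (congrFun (congrFun (hA Q) i) j)

/-- A quasi-invertible element is regular, and one-sidedly invertible modulo every prime ideal. -/
theorem IsQuasiInvertible.isGood {w : R} (hw : IsQuasiInvertible w) :
    IsGood (fun Q : PrimeIdeals R => primeQuotient Q) w := by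
  obtain ⟨a, b, hab⟩ := hw
  refine ⟨⟨a + b - a * w * b, ?_⟩, fun Q => ?_⟩
  · have h := (hab w).1
    rw [← sub_eq_zero, ← neg_eq_zero, ← h]
    noncomm_ring
  · rcases Q.2 _ _ (fun r => by rw [(hab r).1]; exact Q.1.zero_mem) with h | h
    · refine .inr ⟨primeQuotient Q a, ?_⟩
      rw [← primeQuotient_eq_zero, map_sub, map_one, map_mul, sub_eq_zero] at h
      exact h.symm
    · refine .inl ⟨primeQuotient Q b, ?_⟩
      rw [← primeQuotient_eq_zero, map_sub, map_one, map_mul, sub_eq_zero] at h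
      exact h.symm

theorem IsQBRing.hasGoodLifts (h : IsQBRing R) :
    HasGoodLifts R fun Q : PrimeIdeals R => primeQuotient Q := by
  intro x a b hx
  have ha : a ∈ cl {w : R | IsQuasiInvertible w} := by
    have h' : cl {w : R | IsQuasiInvertible w} = Set.univ := h
    rw [h']; trivial
  obtain ⟨y, hy⟩ := ha x b hx
  exact ⟨y, hy.isGood⟩

end Prime

/-! ### Projective right modules and their supports -/

section Modules

variable {R : Type u} [Ring R]

instance (n : ℕ) : Module.Projective Rᵐᵒᵖ (Fin n → R) :=
  Module.Projective.of_equiv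
    (LinearEquiv.piCongrRight fun _ : Fin n => regularEquiv R)

/-- Matrices act on columns from the left, as endomorphisms of the free right module. -/
def matrixEndEquiv (n : ℕ) :
    Matrix (Fin n) (Fin n) R ≃+* Module.End Rᵐᵒᵖ (Fin n → R) where
  toFun T :=
    { toFun := fun z => T.mulVec z
      map_add' := T.mulVec_add
      map_smul' := fun r z => by
        ext k
        simp [Matrix.mulVec, dotProduct, Finset.sum_mul, mul_assoc] }
  invFun f := .of fun k l => f (Pi.single l 1) k
  left_inv T := by ext k l; simp
  right_inv f := by
    refine LinearMap.pi_ext' fun l => LinearMap.ext fun r => ?_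
    have hr : (Pi.single l r : Fin n → R) = MulOpposite.op r • Pi.single l 1 := by
      rw [← Pi.single_smul]; simp
    ext k
    simp only [LinearMap.comp_apply, LinearMap.coe_single, hr, map_smul]
    simp
  map_mul' S T := LinearMap.ext fun z => by simp [Matrix.mulVec_mulVec]
  map_add' S T := LinearMap.ext fun z => Matrix.add_mulVec S T z

theorem matrixEndEquiv_apply (n : ℕ) (T : Matrix (Fin n) (Fin n) R) (z : Fin n → R) :
    matrixEndEquiv n T z = T.mulVec z := rfl

theorem mulVec_mem {n : ℕ} {Q : TwoSidedIdeal R} {T : Matrix (Fin n) (Fin n) R}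
    (hT : ∀ k l, T k l ∈ Q) (z : Fin n → R) (k : Fin n) : T.mulVec z k ∈ Q := by
  change ∑ l, T k l * z l ∈ Q
  exact sum_mem fun l _ => Q.mul_mem_right _ _ (hT k l)

/-- For a `QB`-ring, the endomorphism ring of a free module satisfies the `QB` condition with
quasi-invertibility weakened to a condition modulo each prime ideal. -/
theorem IsQBRing.exists_quasi_inverse (hR : IsQBRing R) {n : ℕ}
    {x a b : Module.End Rᵐᵒᵖ (Fin n → R)} (hx : x * a + b = 1) :
    ∃ y v : Module.End Rᵐᵒᵖ (Fin n → R), (a + y * b) * v * (a + y * b) = a + y * b ∧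
      v * (a + y * b) * v = v ∧ ∀ Q : PrimeIdeals R,
        (∀ z k, (1 - v * (a + y * b)) z k ∈ Q.1) ∨ (∀ z k, (1 - (a + y * b) * v) z k ∈ Q.1) := by
  let e := matrixEndEquiv (R := R) n
  obtain ⟨y, hy⟩ := hR.hasGoodLifts.matrix detectsNilpotents_matrix n
    (e.symm x) (e.symm a) (e.symm b) (by rw [← map_mul, ← map_add, hx, map_one])
  obtain ⟨v, h1, h2, h3⟩ := hy.exists_reflexive
  have hu : e (e.symm a + y * e.symm b) = a + e y * b := by simp
  refine ⟨e y, e v, ?_, ?_, fun Q => ?_⟩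
  · rw [← hu, ← map_mul, ← map_mul, h1]
  · rw [← hu, ← map_mul, ← map_mul, h2]
  · have key (T : Matrix (Fin n) (Fin n) R) (hT : (primeQuotient Q).mapMatrix T = 1) (z k) :
        (1 - e T) z k ∈ Q.1 := by
      rw [← map_one e, ← map_sub]
      refine mulVec_mem (fun k l => ?_) z k
      rw [← primeQuotient_eq_zero]
      have : (primeQuotient Q).mapMatrix (1 - T) = 0 := by rw [map_sub, hT, map_one, sub_self]
      exact congrFun (congrFun this k) l
    rw [← hu, ← map_mul, ← map_mul]
    exact (h3 Q).imp (key _) (key _)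

section Retract

variable {M N N₁ N₂ : Type u} [AddCommGroup M] [Module Rᵐᵒᵖ M] [AddCommGroup N] [Module Rᵐᵒᵖ N]
  [AddCommGroup N₁] [Module Rᵐᵒᵖ N₁] [AddCommGroup N₂] [Module Rᵐᵒᵖ N₂]

theorem projective_of_retract [Module.Projective Rᵐᵒᵖ M] (i : N →ₗ[Rᵐᵒᵖ] M) (r : M →ₗ[Rᵐᵒᵖ] N)
    (h : ∀ x, r (i x) = x) : Module.Projective Rᵐᵒᵖ N :=
  Module.Projective.of_split i r (LinearMap.ext h)

theorem exists_free_retract (M : Type u) [AddCommGroup M] [Module Rᵐᵒᵖ M] [Module.Finite Rᵐᵒᵖ M]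
    [Module.Projective Rᵐᵒᵖ M] :
    ∃ (n : ℕ) (π : (Fin n → R) →ₗ[Rᵐᵒᵖ] M) (s : M →ₗ[Rᵐᵒᵖ] Fin n → R), ∀ m, π (s m) = m := by
  obtain ⟨n, f, hf⟩ := Module.Finite.exists_fin' Rᵐᵒᵖ M
  let π : (Fin n → R) →ₗ[Rᵐᵒᵖ] M :=
    f ∘ₗ (LinearEquiv.piCongrRight fun _ => (regularEquiv R).symm).toLinearMap
  have hπ : Function.Surjective π := hf.comp (LinearEquiv.surjective _)
  obtain ⟨s, hs⟩ := Module.projective_lifting_property π LinearMap.id hπ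
  exact ⟨n, π, s, LinearMap.congr_fun hs⟩

/-- A direct sum decomposition given by inclusions and projections. -/
def equivProdOfRetracts (i₁ : N₁ →ₗ[Rᵐᵒᵖ] M) (r₁ : M →ₗ[Rᵐᵒᵖ] N₁) (i₂ : N₂ →ₗ[Rᵐᵒᵖ] M)
    (r₂ : M →ₗ[Rᵐᵒᵖ] N₂) (h₁ : ∀ x, r₁ (i₁ x) = x) (h₂ : ∀ x, r₂ (i₂ x) = x)
    (h : ∀ x, i₁ (r₁ x) + i₂ (r₂ x) = x) : M ≃ₗ[Rᵐᵒᵖ] N₁ × N₂ where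
  toFun x := (r₁ x, r₂ x)
  map_add' x y := by simp
  map_smul' c x := by simp
  invFun p := i₁ p.1 + i₂ p.2
  left_inv x := h x
  right_inv p := by
    have e1 : r₁ (i₂ p.2) = 0 := by
      have := h (i₂ p.2)
      rw [h₂, add_eq_right] at this
      rw [← h₁ (r₁ (i₂ p.2)), this, map_zero]
    have e2 : r₂ (i₁ p.1) = 0 := by
      have := h (i₁ p.1)
      rw [h₁, add_eq_left] at this
      rw [← h₂ (r₂ (i₁ p.1)), this, map_zero]
    ext <;> simp [e1, e2, h₁, h₂]

end Retract

/-- The summand of a module that is the range of an idempotent endomorphism. -/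
abbrev idemRange {M : Type u} [AddCommGroup M] [Module Rᵐᵒᵖ M] (e : Module.End Rᵐᵒᵖ M) : Type u :=
  LinearMap.range e

section IdemRange

variable {M : Type u} [AddCommGroup M] [Module Rᵐᵒᵖ M] {e : Module.End Rᵐᵒᵖ M}

theorem apply_idemRange (he : IsIdempotentElem e) (x : idemRange e) : e x = x := by
  obtain ⟨_, y, rfl⟩ := x
  exact congrArg (fun f : Module.End Rᵐᵒᵖ M => f y) he.eq

theorem rangeRestrict_idemRange (he : IsIdempotentElem e) (x : idemRange e) :
    e.rangeRestrict (Submodule.subtype _ x) = x :=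
  Subtype.ext (apply_idemRange he x)

theorem finite_idemRange [Module.Finite Rᵐᵒᵖ M] (e : Module.End Rᵐᵒᵖ M) :
    Module.Finite Rᵐᵒᵖ (idemRange e) :=
  Module.Finite.of_surjective e.rangeRestrict e.surjective_rangeRestrict

theorem projective_idemRange [Module.Projective Rᵐᵒᵖ M] (he : IsIdempotentElem e) :
    Module.Projective Rᵐᵒᵖ (idemRange e) :=
  projective_of_retract (Submodule.subtype _) e.rangeRestrict (rangeRestrict_idemRange he)

end IdemRange

section VanishesModulo

/-- Every linear functional on the right module `M` takes values in `Q`. For a projective module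
this says that `M` equals `M Q`. -/
def VanishesModulo (Q : TwoSidedIdeal R) (M : Type u) [AddCommGroup M] [Module Rᵐᵒᵖ M] : Prop :=
  ∀ (h : M →ₗ[Rᵐᵒᵖ] R) (m : M), h m ∈ Q

variable {Q : TwoSidedIdeal R} {M N : Type u} [AddCommGroup M] [Module Rᵐᵒᵖ M] [AddCommGroup N]
  [Module Rᵐᵒᵖ N]

theorem VanishesModulo.of_retract (hM : VanishesModulo Q M) (i : N →ₗ[Rᵐᵒᵖ] M)
    (r : M →ₗ[Rᵐᵒᵖ] N) (h : ∀ x, r (i x) = x) : VanishesModulo Q N := fun f n => by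
  simpa [h] using hM (f ∘ₗ r) (i n)

theorem VanishesModulo.prod (hM : VanishesModulo Q M) (hN : VanishesModulo Q N) :
    VanishesModulo Q (M × N) := fun f p => by
  have : f p = (f ∘ₗ LinearMap.inl _ _ _) p.1 + (f ∘ₗ LinearMap.inr _ _ _) p.2 := by
    simp [← map_add]
  rw [this]
  exact Q.add_mem (hM _ _) (hN _ _)

theorem vanishesModulo_idemRange {n : ℕ} {e : Module.End Rᵐᵒᵖ (Fin n → R)}
    (he : IsIdempotentElem e) (hQ : ∀ z k, e z k ∈ Q) : VanishesModulo Q (idemRange e) := by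
  intro h c
  have hc : h c = ∑ k, (h ∘ₗ e.rangeRestrict) (Pi.single k 1) * (c : Fin n → R) k := by
    conv_lhs => rw [← rangeRestrict_idemRange he c]
    have : (c : Fin n → R) = ∑ k, MulOpposite.op ((c : Fin n → R) k) • Pi.single k (1 : R) := by
      ext l
      simp [Finset.sum_apply, Pi.single_apply]
    conv_lhs => rw [Submodule.subtype_apply, this, map_sum, map_sum]
    exact Finset.sum_congr rfl fun k _ => by rw [map_smul, map_smul]; rfl
  rw [hc]
  refine sum_mem fun k _ => Q.mul_mem_left _ _ ?_
  rw [← apply_idemRange he c]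
  exact hQ _ _

/-- A finitely generated projective module that vanishes modulo every prime ideal is zero: it is the
range of an idempotent matrix with entries in the prime radical. -/
theorem subsingleton_of_vanishesModulo [Module.Finite Rᵐᵒᵖ M] [Module.Projective Rᵐᵒᵖ M]
    (h : ∀ Q : PrimeIdeals R, VanishesModulo Q.1 M) : Subsingleton M := by
  obtain ⟨n, π, s, hs'⟩ := exists_free_retract (R := R) M
  obtain ⟨A, hA⟩ := (matrixEndEquiv n).surjective (s ∘ₗ π)
  have hidem : IsIdempotentElem A := by
    apply (matrixEndEquiv n).injective
    rw [map_mul, hA]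
    ext z
    simp [hs']
  have hnil : IsNilpotent A := isNilpotent_of_forall_prime A fun Q k l => by
    have h1 : A k l = (LinearMap.proj k ∘ₗ s) (π (Pi.single l 1)) := by
      have := congrFun (LinearMap.congr_fun hA (Pi.single l 1)) k
      simpa [matrixEndEquiv_apply] using this
    rw [h1]
    exact h Q _ _
  obtain ⟨k, hk⟩ := hnil
  have hA0 : A = 0 := by
    rw [← hidem.pow_succ_eq k, pow_succ, hk, zero_mul]
  refine subsingleton_of_forall_eq 0 fun m => ?_
  have : s m = 0 := by
    have := LinearMap.congr_fun hA (s m)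
    rw [hA0, map_zero] at this
    simpa [hs'] using this.symm
  rw [← hs' m, this, map_zero]

end VanishesModulo

section Monoid

theorem V.exists_mk (x : V R) : ∃ M : FGProj R, x = V.mk M.carrier := by
  obtain ⟨M, rfl⟩ := Quotient.exists_rep x
  exact ⟨M, rfl⟩

theorem V.mk_eq_add_of_retracts {M N₁ N₂ : Type u} [AddCommGroup M] [Module Rᵐᵒᵖ M]
    [Module.Finite Rᵐᵒᵖ M] [Module.Projective Rᵐᵒᵖ M]
    [AddCommGroup N₁] [Module Rᵐᵒᵖ N₁] [Module.Finite Rᵐᵒᵖ N₁] [Module.Projective Rᵐᵒᵖ N₁]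
    [AddCommGroup N₂] [Module Rᵐᵒᵖ N₂] [Module.Finite Rᵐᵒᵖ N₂] [Module.Projective Rᵐᵒᵖ N₂]
    (i₁ : N₁ →ₗ[Rᵐᵒᵖ] M) (r₁ : M →ₗ[Rᵐᵒᵖ] N₁) (i₂ : N₂ →ₗ[Rᵐᵒᵖ] M)
    (r₂ : M →ₗ[Rᵐᵒᵖ] N₂) (h₁ : ∀ x, r₁ (i₁ x) = x) (h₂ : ∀ x, r₂ (i₂ x) = x)
    (h : ∀ x, i₁ (r₁ x) + i₂ (r₂ x) = x) : (V.mk M : V R) = V.mk N₁ + V.mk N₂ := by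
  rw [V.mk_add_mk, V.mk_eq_mk]
  exact ⟨equivProdOfRetracts i₁ r₁ i₂ r₂ h₁ h₂ h⟩

theorem V.mk_eq_zero {M : Type u} [AddCommGroup M] [Module Rᵐᵒᵖ M]
    [Module.Finite Rᵐᵒᵖ M] [Module.Projective Rᵐᵒᵖ M] [Subsingleton M] : (V.mk M : V R) = 0 :=
  V.mk_eq_mk.2 ⟨LinearEquiv.ofSubsingleton M PUnit.{u + 1}⟩

theorem V.mk_le_of_retract {M N : Type u} [AddCommGroup M] [Module Rᵐᵒᵖ M]
    [Module.Finite Rᵐᵒᵖ M] [Module.Projective Rᵐᵒᵖ M]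
    [AddCommGroup N] [Module Rᵐᵒᵖ N] [Module.Finite Rᵐᵒᵖ N] [Module.Projective Rᵐᵒᵖ N]
    (i : N →ₗ[Rᵐᵒᵖ] M) (r : M →ₗ[Rᵐᵒᵖ] N) (h : ∀ x, r (i x) = x) :
    (V.mk N : V R) ≤ V.mk M := by
  let e : Module.End Rᵐᵒᵖ M := 1 - i ∘ₗ r
  have he : IsIdempotentElem e := by
    refine IsIdempotentElem.one_sub (a := (i ∘ₗ r : Module.End Rᵐᵒᵖ M)) ?_
    ext x
    simp [h]
  have := finite_idemRange e
  have := projective_idemRange he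
  refine ⟨V.mk (idemRange e), (V.mk_eq_add_of_retracts i r (Submodule.subtype _) e.rangeRestrict h
    (rangeRestrict_idemRange he) fun x => ?_).symm⟩
  simp [e]

theorem V.nsmul_one (n : ℕ) : n • (1 : V R) = V.mk (Fin n → R) := by
  induction n with
  | zero => rw [zero_smul]; exact V.mk_eq_zero.symm
  | succ n ih =>
    rw [succ_nsmul, ih, add_comm]
    change V.mk R + V.mk (Fin n → R) = _
    rw [V.mk_add_mk, V.mk_eq_mk]
    exact ⟨Fin.consLinearEquiv Rᵐᵒᵖ fun _ : Fin (n + 1) => R⟩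

/-- The classes of the modules that vanish modulo the ideal `Q`. -/
def V.Vanishes (Q : TwoSidedIdeal R) : V R → Prop :=
  Quotient.lift (fun M => VanishesModulo Q M.carrier) fun _ _ ⟨e⟩ => propext
    ⟨fun h => h.of_retract e.symm.toLinearMap e.toLinearMap e.apply_symm_apply,
      fun h => h.of_retract e.toLinearMap e.symm.toLinearMap e.symm_apply_apply⟩

theorem V.Vanishes.add {Q : TwoSidedIdeal R} {x y : V R} (hx : x.Vanishes Q) (hy : y.Vanishes Q) :
    (x + y).Vanishes Q := by
  obtain ⟨M, rfl⟩ := x.exists_mk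
  obtain ⟨N, rfl⟩ := y.exists_mk
  exact VanishesModulo.prod hx hy

theorem V.Vanishes.of_le {Q : TwoSidedIdeal R} {x y : V R} (hxy : x ≤ y) (hy : y.Vanishes Q) :
    x.Vanishes Q := by
  obtain ⟨z, rfl⟩ := hxy
  obtain ⟨M, rfl⟩ := x.exists_mk
  obtain ⟨N, rfl⟩ := z.exists_mk
  exact VanishesModulo.of_retract hy (LinearMap.inl _ _ _) (LinearMap.fst _ _ _) fun _ => rfl

theorem V.vanishes_zero (Q : TwoSidedIdeal R) : (0 : V R).Vanishes Q := fun h m => by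
  rw [Subsingleton.elim m 0, map_zero]
  exact Q.zero_mem

theorem V.eq_zero_of_vanishes {x : V R} (h : ∀ Q : PrimeIdeals R, x.Vanishes Q.1) : x = 0 := by
  obtain ⟨M, rfl⟩ := x.exists_mk
  have := subsingleton_of_vanishesModulo (M := M.carrier) h
  exact V.mk_eq_zero

/-- The classes whose support in the prime spectrum is contained in the support of `c`. -/
def supportIdeal (c : V R) : AddSubmonoid (V R) where
  carrier := {x | ∀ Q : PrimeIdeals R, c.Vanishes Q.1 → x.Vanishes Q.1}
  zero_mem' Q _ := V.vanishes_zero Q.1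
  add_mem' hx hy Q hQ := (hx Q hQ).add (hy Q hQ)

theorem mem_supportIdeal_self (c : V R) : c ∈ supportIdeal c := fun _ h => h

/-- Classes with disjoint supports in the prime spectrum have orthogonal support ideals. -/
theorem orthogonal_supportIdeal {c d : V R}
    (h : ∀ Q : PrimeIdeals R, c.Vanishes Q.1 ∨ d.Vanishes Q.1) :
    OrthogonalOrderIdeals (supportIdeal c) (supportIdeal d) := by
  refine ⟨fun x y hxy hy Q hQ => (hy Q hQ).of_le hxy, fun x y hxy hy Q hQ => (hy Q hQ).of_le hxy,
    (AddSubmonoid.eq_bot_iff_forall _).2 fun x hx => ?_⟩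
  obtain ⟨hc, hd⟩ := AddSubmonoid.mem_inf.1 hx
  exact V.eq_zero_of_vanishes fun Q => (h Q).elim (hc Q) (hd Q)

end Monoid

end Modules

/-! ### Cancellation over `QB`-rings -/

section Cancellation

variable {R : Type u} [Ring R]

theorem isIdempotentElem_mul_of_quasi {S : Type*} [Ring S] {w v : S} (h : w * v * w = w) :
    IsIdempotentElem (w * v) := by
  change w * v * (w * v) = w * v
  rw [← mul_assoc, h]

/-- The ranges of the idempotents `w v` and `v w` are isomorphic. -/
theorem V.mk_idemRange_mul_comm {A : Type u} [AddCommGroup A] [Module Rᵐᵒᵖ A]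
    [Module.Finite Rᵐᵒᵖ A] [Module.Projective Rᵐᵒᵖ A] {w v : Module.End Rᵐᵒᵖ A}
    (h1 : IsIdempotentElem (w * v)) (h2 : IsIdempotentElem (v * w))
    [Module.Finite Rᵐᵒᵖ (idemRange (w * v))] [Module.Projective Rᵐᵒᵖ (idemRange (w * v))]
    [Module.Finite Rᵐᵒᵖ (idemRange (v * w))] [Module.Projective Rᵐᵒᵖ (idemRange (v * w))] :
    (V.mk (idemRange (w * v)) : V R) = V.mk (idemRange (v * w)) := by
  have e1 (x : idemRange (w * v)) : w (v x) = x := apply_idemRange h1 x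
  have e2 (x : idemRange (v * w)) : v (w x) = x := apply_idemRange h2 x
  refine V.mk_eq_mk.2 ⟨LinearEquiv.ofLinearMap
    ((v * w).rangeRestrict ∘ₗ v ∘ₗ Submodule.subtype _)
    ((w * v).rangeRestrict ∘ₗ w ∘ₗ Submodule.subtype _) ?_ ?_⟩
  · ext x
    change v (w (v (w (v (w x))))) = x
    rw [e2, e2, e2]
  · ext x
    change w (v (w (v (w (v x))))) = x
    rw [e1, e1, e1]

/-- Two decompositions `A ⊕ B₁ ≅ P ≅ A ⊕ B₂` such that the composite `w` of the second inclusion and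
the first projection of `A` is regular: then `B₁` plus the cokernel of `w` is isomorphic to
`B₂` plus its kernel, both being isomorphic to the complement of `j (v A)` in `P`. -/
theorem nonempty_equiv_of_quasi_inverse {A P B₁ B₂ : Type u} [AddCommGroup A] [Module Rᵐᵒᵖ A]
    [AddCommGroup P] [Module Rᵐᵒᵖ P] [AddCommGroup B₁] [Module Rᵐᵒᵖ B₁] [AddCommGroup B₂]
    [Module Rᵐᵒᵖ B₂] {i j : A →ₗ[Rᵐᵒᵖ] P} {p q : P →ₗ[Rᵐᵒᵖ] A} {k₁ : B₁ →ₗ[Rᵐᵒᵖ] P}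
    {l₁ : P →ₗ[Rᵐᵒᵖ] B₁} {k₂ : B₂ →ₗ[Rᵐᵒᵖ] P} {l₂ : P →ₗ[Rᵐᵒᵖ] B₂}
    (hpi : ∀ x, p (i x) = x) (hlk₁ : ∀ x, l₁ (k₁ x) = x) (hli₁ : ∀ x, l₁ (i x) = 0)
    (hpk₁ : ∀ x, p (k₁ x) = 0) (h₁ : ∀ x, i (p x) + k₁ (l₁ x) = x)
    (hqj : ∀ x, q (j x) = x) (hlk₂ : ∀ x, l₂ (k₂ x) = x) (hlj₂ : ∀ x, l₂ (j x) = 0)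
    (hqk₂ : ∀ x, q (k₂ x) = 0) (h₂ : ∀ x, j (q x) + k₂ (l₂ x) = x)
    {w v : Module.End Rᵐᵒᵖ A} (hw : ∀ x, p (j x) = w x) (hwv : w * v * w = w)
    (hvw : v * w * v = v) :
    Nonempty ((B₁ × idemRange (1 - w * v)) ≃ₗ[Rᵐᵒᵖ] (B₂ × idemRange (1 - v * w))) := by
  have hwv' (x : A) : w (v (w x)) = w x := LinearMap.congr_fun hwv x
  have hvw' (x : A) : v (w (v x)) = v x := LinearMap.congr_fun hvw x
  have hc₁ := (isIdempotentElem_mul_of_quasi hwv).one_sub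
  have hc₂ := (isIdempotentElem_mul_of_quasi hvw).one_sub
  have hv0 (c : idemRange (1 - w * v)) : v (c : A) = 0 := by
    rw [← apply_idemRange hc₁ c]
    simp [hvw']
  have hw0 (c : idemRange (1 - v * w)) : w (c : A) = 0 := by
    rw [← apply_idemRange hc₂ c]
    simp [hwv']
  let E : P →ₗ[Rᵐᵒᵖ] P := LinearMap.id - j ∘ₗ v ∘ₗ p
  let s₁ : B₁ × idemRange (1 - w * v) →ₗ[Rᵐᵒᵖ] P := k₁.coprod (i ∘ₗ Submodule.subtype _)
  let r₁ : P →ₗ[Rᵐᵒᵖ] B₁ × idemRange (1 - w * v) := l₁.prod ((1 - w * v).rangeRestrict ∘ₗ p)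
  let s₂ : B₂ × idemRange (1 - v * w) →ₗ[Rᵐᵒᵖ] P := k₂.coprod (j ∘ₗ Submodule.subtype _)
  let r₂ : P →ₗ[Rᵐᵒᵖ] B₂ × idemRange (1 - v * w) := l₂.prod ((1 - v * w).rangeRestrict ∘ₗ q)
  have hE (x : P) : E x = x - j (v (p x)) := rfl
  have hs₁ (z) : s₁ z = k₁ z.1 + i (z.2 : A) := rfl
  have hs₂ (z) : s₂ z = k₂ z.1 + j (z.2 : A) := rfl
  have hrs₁ (z) : r₁ (s₁ z) = z := by
    refine Prod.ext ?_ (Subtype.ext ?_)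
    · simp [r₁, hs₁, hlk₁, hli₁]
    · simp [r₁, hs₁, hpk₁, hpi, hv0]
  have hrs₂ (z) : r₂ (s₂ z) = z := by
    refine Prod.ext ?_ (Subtype.ext ?_)
    · simp [r₂, hs₂, hlk₂, hlj₂]
    · simp [r₂, hs₂, hqk₂, hqj, hw0]
  have hsr₁ (x) : s₁ (r₁ x) = x - i (w (v (p x))) := by
    conv_rhs => rw [← h₁ x]
    simp [r₁, hs₁, hpk₁, hpi]
    abel
  have hsr₂ (x) : s₂ (r₂ x) = x - j (v (w (q x))) := by
    conv_rhs => rw [← h₂ x]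
    simp [r₂, hs₂, hqk₂, hqj]
    abel
  have hEs (z) : E (s₁ z) = s₁ z := by
    simp [hE, hs₁, hpk₁, hpi, hv0]
  refine ⟨LinearEquiv.ofLinearMap (r₂ ∘ₗ s₁) (r₁ ∘ₗ E ∘ₗ s₂) (LinearMap.ext fun z => ?_)
    (LinearMap.ext fun z => ?_)⟩
  · change r₂ (s₁ (r₁ (E (s₂ z)))) = z
    have e1 : s₁ (r₁ (E (s₂ z))) = E (s₂ z) := by
      rw [hsr₁]
      simp [hE, hw, hvw']
    have e2 : r₂ (j (v (p (s₂ z)))) = 0 := by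
      refine Prod.ext ?_ (Subtype.ext ?_)
      · simp [r₂, hlj₂]
      · simp [r₂, hqj, hvw']
    rw [e1, hE, map_sub, hrs₂, e2, sub_zero]
  · change r₁ (E (s₂ (r₂ (s₁ z)))) = z
    have e1 : E (j (v (w (q (s₁ z))))) = 0 := by
      simp [hE, hw, hwv']
    rw [hsr₂, map_sub, e1, sub_zero, hEs, hrs₁]

theorem IsQBRing.unitCancellation (hR : IsQBRing R) : UnitCancellation R := by
  intro n _ b₁ b₂ h
  obtain ⟨B₁, rfl⟩ := b₁.exists_mk
  obtain ⟨B₂, rfl⟩ := b₂.exists_mk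
  rw [V.nsmul_one, V.mk_add_mk, V.mk_add_mk, V.mk_eq_mk] at h
  obtain ⟨e⟩ := h
  let i : (Fin n → R) →ₗ[Rᵐᵒᵖ] (Fin n → R) × B₁.carrier := LinearMap.inl _ _ _
  let p₀ : (Fin n → R) × B₁.carrier →ₗ[Rᵐᵒᵖ] (Fin n → R) := LinearMap.fst _ _ _
  let j : (Fin n → R) →ₗ[Rᵐᵒᵖ] (Fin n → R) × B₁.carrier :=
    e.symm.toLinearMap ∘ₗ LinearMap.inl _ _ _
  let q : (Fin n → R) × B₁.carrier →ₗ[Rᵐᵒᵖ] (Fin n → R) := LinearMap.fst _ _ _ ∘ₗ e.toLinearMap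
  let x : Module.End Rᵐᵒᵖ (Fin n → R) := q ∘ₗ i
  let a : Module.End Rᵐᵒᵖ (Fin n → R) := p₀ ∘ₗ j
  let b : Module.End Rᵐᵒᵖ (Fin n → R) := q ∘ₗ (LinearMap.id - i ∘ₗ p₀) ∘ₗ j
  have hqj (z) : q (j z) = z := by simp [q, j]
  have hpi₀ (z) : p₀ (i z) = z := rfl
  have hx : x * a + b = 1 := by
    refine LinearMap.ext fun z => ?_
    change q (i (p₀ (j z))) + q (j z - i (p₀ (j z))) = z
    rw [← map_add, add_sub_cancel, hqj]
  obtain ⟨y, v, h1, h2, h3⟩ := hR.exists_quasi_inverse hx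
  obtain ⟨w, hw⟩ : ∃ w, w = a + y * b := ⟨_, rfl⟩
  rw [← hw] at h1 h2 h3
  -- another projection onto the first copy of `Rⁿ`; its kernel is still isomorphic to `B₁`
  let p : (Fin n → R) × B₁.carrier →ₗ[Rᵐᵒᵖ] (Fin n → R) :=
    p₀ + y ∘ₗ q ∘ₗ (LinearMap.id - i ∘ₗ p₀)
  have hp (z) : p z = p₀ z + y (q (z - i (p₀ z))) := rfl
  have hpi (z) : p (i z) = z := by simp [hp, hpi₀]
  have hpj (z) : p (j z) = w z := by rw [hw]; rfl
  have hwv := isIdempotentElem_mul_of_quasi h1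
  have hvw := isIdempotentElem_mul_of_quasi h2
  have := finite_idemRange (w * v)
  have := finite_idemRange (v * w)
  have := finite_idemRange (1 - w * v)
  have := finite_idemRange (1 - v * w)
  have := projective_idemRange hwv
  have := projective_idemRange hvw
  have := projective_idemRange hwv.one_sub
  have := projective_idemRange hvw.one_sub
  have key := nonempty_equiv_of_quasi_inverse (i := i) (j := j) (p := p) (q := q)
    (k₁ := (LinearMap.id - i ∘ₗ p) ∘ₗ LinearMap.inr _ _ _) (l₁ := LinearMap.snd _ _ _)
    (k₂ := e.symm.toLinearMap ∘ₗ LinearMap.inr _ _ _)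
    (l₂ := LinearMap.snd _ _ _ ∘ₗ e.toLinearMap) hpi (fun z => by simp [i]) (fun z => by simp [i])
    (fun z => by simp [hpi])
    (fun z => by
      have hz : (0, z.2) = z - i z.1 := by ext <;> simp [i]
      simp [hz, hpi])
    hqj (fun z => by simp) (fun z => by simp [j]) (fun z => by simp [q])
    (fun z => by
      apply e.injective
      simp [j, q])
    hpj h1 h2
  refine ⟨_, _, orthogonal_supportIdeal (c := V.mk (idemRange (1 - w * v)))
    (d := V.mk (idemRange (1 - v * w))) fun Q => ?_, V.mk (idemRange (w * v)), _, _,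
    mem_supportIdeal_self _, mem_supportIdeal_self _, ?_, ?_, ?_⟩
  · exact (h3 Q).symm.imp (vanishesModulo_idemRange hwv.one_sub)
      (vanishesModulo_idemRange hvw.one_sub)
  · exact V.mk_eq_mk.2 key
  · rw [V.nsmul_one]
    exact (V.mk_eq_add_of_retracts _ _ _ _ (rangeRestrict_idemRange hwv)
      (rangeRestrict_idemRange hwv.one_sub) fun z => by simp).symm
  · rw [V.nsmul_one, V.mk_idemRange_mul_comm hwv hvw]
    exact V.mk_eq_add_of_retracts _ _ _ _ (rangeRestrict_idemRange hvw)
      (rangeRestrict_idemRange hvw.one_sub) fun z => by simp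

theorem V.exists_add_eq_nsmul_one (a : V R) : ∃ (a' : V R) (n : ℕ), 1 ≤ n ∧ a + a' = n • 1 := by
  obtain ⟨M, rfl⟩ := a.exists_mk
  obtain ⟨n, π, s, hs⟩ := exists_free_retract (R := R) M.carrier
  obtain ⟨z, hz⟩ := V.mk_le_of_retract s π hs
  exact ⟨z + 1, n + 1, n.succ_pos, by rw [← add_assoc, hz, succ_nsmul, V.nsmul_one]⟩

theorem UnitCancellation.orthogonalCancellation (h : UnitCancellation R) :
    OrthogonalCancellation R := by
  intro a b₁ b₂ hab
  obtain ⟨a', n, hn, ha⟩ := a.exists_add_eq_nsmul_one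
  obtain ⟨S₁, S₂, hS, x, c₁, c₂, h₁, h₂, hc, -, -⟩ := h n hn b₁ b₂ (by
    rw [← ha, add_comm a, add_assoc, add_assoc, hab])
  exact ⟨S₁, S₂, hS, c₁, c₂, h₁, h₂, hc⟩

end Cancellation

/-! ### Semi-primitive exchange rings -/

section Exchange

variable {R : Type u} [Ring R]

/-- A left-handed form of the exchange property: for a left unimodular pair `a, b` there is an
idempotent `f` in `R b` with `1 - f` in `R a`. It comes from the exchange property of the kernel of
the row `(x, 1)` in `R ⊕ R`, which is the range of the idempotent
`!![1 - a x, -a; -x (1 - a x), x a]`. -/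
theorem IsExchangeRing.exists_left (hE : IsExchangeRing R) {x a b : R} (hx : x * a + b = 1) :
    ∃ f y z : R, IsIdempotentElem f ∧ f = z * b ∧ 1 - f = y * a := by
  obtain ⟨p, hp, ⟨r₀, hr₀⟩, s₀, hs₀⟩ := hE (1 - a * x)
  rw [sub_sub_cancel] at hs₀
  have hp' : p * (1 - p) = 0 := by rw [mul_sub, mul_one, hp.eq, sub_self]
  have hp'' : (1 - p) * p = 0 := by rw [sub_mul, one_mul, hp.eq, sub_self]
  obtain ⟨r, hr⟩ : ∃ r, r = r₀ * p := ⟨_, rfl⟩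
  obtain ⟨s, hs⟩ : ∃ s, s = s₀ * (1 - p) := ⟨_, rfl⟩
  have hr1 : (1 - a * x) * r = p := by rw [hr, ← mul_assoc, ← hr₀, hp.eq]
  have hs1 : a * x * s = 1 - p := by rw [hs, ← mul_assoc, ← hs₀, hp.one_sub.eq]
  have hrp : r * (1 - p) = 0 := by rw [hr, mul_assoc, hp', mul_zero]
  have hsp : s * (1 - p) = s := by rw [hs, mul_assoc, hp.one_sub.eq]
  have hb : b = 1 - x * a := eq_sub_of_add_eq' hx
  obtain ⟨m, hm⟩ : ∃ m, m = x * (r - s) * a := ⟨_, rfl⟩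
  have hbm : b * m = x * (1 - s) * a := by
    calc b * m = x * ((1 - a * x) * r - s + a * x * s) * a := by rw [hb, hm]; noncomm_ring
      _ = _ := by rw [hr1, hs1]; congr 2; abel
  have h1 : 1 - (1 + m) * b = x * a - m * b := by rw [add_mul, one_mul, hb]; noncomm_ring
  have h2 : b * (x * a - m * b) = x * s * a * b := by
    rw [mul_sub, ← mul_assoc b m, hbm, hb]; noncomm_ring
  refine ⟨(1 + m) * b, x - x * (r - s) * (1 - a * x), 1 + m, ?_, rfl, ?_⟩
  · have : (1 + m) * b * (1 - (1 + m) * b) = 0 := by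
      rw [h1, mul_assoc, h2, hm]
      calc (1 + x * (r - s) * a) * (x * s * a * b)
          = x * s * a * b + x * ((r - s) * (a * x * s)) * a * b := by noncomm_ring
        _ = 0 := by rw [hs1, sub_mul, hrp, hsp]; noncomm_ring
    rw [mul_sub, mul_one, sub_eq_zero] at this
    exact this.symm
  · rw [h1, hm, hb]; noncomm_ring

/-- In a semi-primitive exchange ring every nonzero right ideal contains a nonzero idempotent. -/
theorem IsExchangeRing.exists_idempotent_ne_zero (hE : IsExchangeRing R) (hS : IsSemiprimitive R)
    {r : R} (hr : r ≠ 0) : ∃ s : R, IsIdempotentElem (r * s) ∧ r * s ≠ 0 := by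
  by_contra! h
  refine hr ?_
  have hinv (y : R) : ∃ s, (1 - r * y) * s = 1 := by
    obtain ⟨p, hp, ⟨t, ht⟩, s, hs⟩ := hE (r * y)
    have hp0 : p = 0 := by
      rw [ht, mul_assoc]
      exact h _ (by rw [← mul_assoc, ← ht]; exact hp)
    exact ⟨s, by rw [← hs, hp0, sub_zero]⟩
  have hmem : r ∈ Ring.jacobson R := by
    rw [← Ideal.jacobson_bot, Ideal.mem_jacobson_iff]
    intro y
    obtain ⟨s, hs⟩ := hinv (-y)
    -- the right inverse `s` of `1 + r y` is itself right invertible, hence a two-sided inverse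
    obtain ⟨s', hs'⟩ := hinv (y * s)
    have h1 : 1 - r * (y * s) = s := by
      have : s + r * (y * s) = 1 := by rw [← hs]; noncomm_ring
      exact sub_eq_of_eq_add this.symm
    rw [h1] at hs'
    have h2 : s * (1 - r * -y) = 1 := by
      rw [left_inv_eq_right_inv hs hs', hs']
    refine ⟨1 - y * s * r, ?_⟩
    have : (1 - y * s * r) * y * r + (1 - y * s * r) - 1 = y * (1 - s * (1 - r * -y)) * r := by
      noncomm_ring
    rw [this, h2]
    simp
  have hS' : Ring.jacobson R = ⊥ := hS
  rw [hS'] at hmem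
  exact hmem

/-- The diagonal entries `α : A → C` and `α' : C → A` of an isomorphism `A ⊕ B ≅ C ⊕ D` and its
inverse are mutually inverse up to endomorphisms of `A` and `C` that factor through `D` and `B`. -/
theorem exists_factors_of_prod_equiv {A B C D : Type u} [AddCommGroup A] [Module Rᵐᵒᵖ A]
    [AddCommGroup B] [Module Rᵐᵒᵖ B] [AddCommGroup C] [Module Rᵐᵒᵖ C] [AddCommGroup D]
    [Module Rᵐᵒᵖ D] (e : (A × B) ≃ₗ[Rᵐᵒᵖ] (C × D)) :
    ∃ (α : A →ₗ[Rᵐᵒᵖ] C) (α' : C →ₗ[Rᵐᵒᵖ] A) (δ : A →ₗ[Rᵐᵒᵖ] D) (δ' : D →ₗ[Rᵐᵒᵖ] A)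
      (γ : C →ₗ[Rᵐᵒᵖ] B) (γ' : B →ₗ[Rᵐᵒᵖ] C), (∀ z, α' (α z) + δ' (δ z) = z) ∧
      ∀ z, α (α' z) + γ' (γ z) = z := by
  refine ⟨LinearMap.fst _ _ _ ∘ₗ e.toLinearMap ∘ₗ LinearMap.inl _ _ _,
    LinearMap.fst _ _ _ ∘ₗ e.symm.toLinearMap ∘ₗ LinearMap.inl _ _ _,
    LinearMap.snd _ _ _ ∘ₗ e.toLinearMap ∘ₗ LinearMap.inl _ _ _,
    LinearMap.fst _ _ _ ∘ₗ e.symm.toLinearMap ∘ₗ LinearMap.inr _ _ _,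
    LinearMap.snd _ _ _ ∘ₗ e.symm.toLinearMap ∘ₗ LinearMap.inl _ _ _,
    LinearMap.fst _ _ _ ∘ₗ e.toLinearMap ∘ₗ LinearMap.inr _ _ _, fun z => ?_, fun z => ?_⟩
  · change (e.symm ((e (z, 0)).1, 0)).1 + (e.symm (0, (e (z, 0)).2)).1 = z
    rw [← Prod.fst_add, ← map_add, Prod.mk_add_mk, add_zero, zero_add, Prod.mk.eta,
      e.symm_apply_apply]
  · change (e ((e.symm (z, 0)).1, 0)).1 + (e (0, (e.symm (z, 0)).2)).1 = z
    rw [← Prod.fst_add, ← map_add, Prod.mk_add_mk, add_zero, zero_add, Prod.mk.eta,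
      e.apply_symm_apply]

/-- In a semi-primitive exchange ring, elements of `R` that factor through modules from orthogonal
order-ideals annihilate each other: a nonzero product would yield a nonzero idempotent whose range
is a summand of both modules. -/
theorem IsExchangeRing.mul_mul_eq_zero_of_factor (hE : IsExchangeRing R) (hS : IsSemiprimitive R)
    {S T : AddSubmonoid (V R)} (hST : OrthogonalOrderIdeals S T) {B D : FGProj R}
    (hB : V.mk B.carrier ∈ S) (hD : V.mk D.carrier ∈ T) {g f : R}
    (ν : R →ₗ[Rᵐᵒᵖ] B.carrier) (ν' : B.carrier →ₗ[Rᵐᵒᵖ] R) (hν : ∀ z, ν' (ν z) = g * z)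
    (μ : R →ₗ[Rᵐᵒᵖ] D.carrier) (μ' : D.carrier →ₗ[Rᵐᵒᵖ] R) (hμ : ∀ z, μ' (μ z) = f * z) (r : R) :
    g * r * f = 0 := by
  by_contra h
  obtain ⟨s, hs, hs0⟩ := hE.exists_idempotent_ne_zero hS h
  refine hs0 ?_
  let L := RingEquiv.moduleEndSelfOp R
  let p : Module.End Rᵐᵒᵖ R := L (g * r * f * s)
  have hp : IsIdempotentElem p := hs.map L
  have hpz (z : R) : p z = g * (r * (f * (s * z))) := by
    change g * r * f * s * z = _
    simp only [mul_assoc]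
  have := finite_idemRange p
  have := projective_idemRange hp
  have h1 : (V.mk (idemRange p) : V R) ∈ S := by
    refine hST.1 _ _ (V.mk_le_of_retract (ν ∘ₗ L (r * f * s) ∘ₗ Submodule.subtype _)
      (p.rangeRestrict ∘ₗ ν') fun x => ?_) hB
    have : ν' (ν (L (r * f * s) (x : R))) = p x := by
      rw [hν, hpz]
      change g * (r * f * s * x) = _
      simp only [mul_assoc]
    refine Subtype.ext ?_
    change p (ν' (ν (L (r * f * s) (x : R)))) = x
    rw [this, apply_idemRange hp, apply_idemRange hp]
  have h2 : (V.mk (idemRange p) : V R) ∈ T := by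
    refine hST.2.1 _ _ (V.mk_le_of_retract (μ ∘ₗ L s ∘ₗ Submodule.subtype _)
      (p.rangeRestrict ∘ₗ L (g * r) ∘ₗ μ') fun x => ?_) hD
    have : L (g * r) (μ' (μ (L s (x : R)))) = p x := by
      rw [hμ, hpz]
      change g * r * (f * (s * x)) = _
      simp only [mul_assoc]
    refine Subtype.ext ?_
    change p (L (g * r) (μ' (μ (L s (x : R))))) = x
    rw [this, apply_idemRange hp, apply_idemRange hp]
  have h3 : (V.mk (idemRange p) : V R) = 0 := by
    have := AddSubmonoid.mem_inf.2 ⟨h1, h2⟩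
    rw [hST.2.2] at this
    exact AddSubmonoid.mem_bot.1 this
  obtain ⟨e⟩ := V.mk_eq_mk.1 h3
  have h4 : p.rangeRestrict 1 = 0 := e.injective (Subsingleton.elim _ _)
  have h5 : p 1 = 0 := congrArg Subtype.val h4
  rw [hpz, mul_one] at h5
  simpa only [mul_assoc] using h5

/-- A left unimodular pair `a, b` leads to a regular element `t` in `a + R b` whose kernel `f R` and
cokernel `g R` satisfy `t R ⊕ f R ≅ R = t R ⊕ g R`. Cancellation makes `f R` and `g R` isomorphic up
to adding modules from orthogonal order-ideals; adding the induced map `f R → g R` to `t` leaves the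
defects `1 - u u'` and `1 - u' u` factoring through these modules. -/
theorem OrthogonalCancellation.isQBRing (hS : IsSemiprimitive R) (hE : IsExchangeRing R)
    (hR : OrthogonalCancellation R) : IsQBRing R := by
  refine Set.eq_univ_of_forall fun a x b hx => ?_
  obtain ⟨f, y, z, hf, hfz, hfy⟩ := hE.exists_left hx
  -- `t = a - a f` is a regular element of `a + R b` with kernel `f R`
  obtain ⟨t, ht⟩ : ∃ t, t = a * (1 - f) := ⟨_, rfl⟩
  obtain ⟨v, hv⟩ : ∃ v, v = (1 - f) * y := ⟨_, rfl⟩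
  have hvt : v * t = 1 - f := by
    rw [hv, ht]
    calc (1 - f) * y * (a * (1 - f)) = (1 - f) * (y * a) * (1 - f) := by noncomm_ring
      _ = _ := by rw [← hfy, hf.one_sub.eq, hf.one_sub.eq]
  have htf : t * f = 0 := by rw [ht, mul_assoc, sub_mul, one_mul, hf.eq, sub_self, mul_zero]
  have hfv : f * v = 0 := by rw [hv, ← mul_assoc, mul_sub, mul_one, hf.eq, sub_self, zero_mul]
  have htvt : t * v * t = t := by rw [mul_assoc, hvt, mul_sub, mul_one, htf, sub_zero]
  have htv : IsIdempotentElem (t * v) := isIdempotentElem_mul_of_quasi htvt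
  obtain ⟨g, hg⟩ : ∃ g, g = 1 - t * v := ⟨_, rfl⟩
  have hgg : IsIdempotentElem g := hg ▸ htv.one_sub
  have hvg : v * g = 0 := by
    rw [hg, mul_sub, mul_one, ← mul_assoc, hvt, sub_mul, one_mul, hfv]; simp
  have hgt : g * t = 0 := by rw [hg, sub_mul, one_mul, htvt, sub_self]
  let L := RingEquiv.moduleEndSelfOp R
  have hf' : IsIdempotentElem (L f) := hf.map L
  have hg' : IsIdempotentElem (L g) := hgg.map L
  have hw : IsIdempotentElem (L t * L v) := by rw [← map_mul]; exact htv.map L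
  have hw' : IsIdempotentElem (L v * L t) := by rw [← map_mul, hvt]; exact hf.one_sub.map L
  have := finite_idemRange (L f)
  have := finite_idemRange (L g)
  have := finite_idemRange (L t * L v)
  have := finite_idemRange (L v * L t)
  have := projective_idemRange hf'
  have := projective_idemRange hg'
  have := projective_idemRange hw
  have := projective_idemRange hw'
  have e1 : (V.mk R : V R) = V.mk (idemRange (L t * L v)) + V.mk (idemRange (L g)) := by
    refine V.mk_eq_add_of_retracts _ _ _ _ (rangeRestrict_idemRange hw)
      (rangeRestrict_idemRange hg') fun c => ?_
    change t * (v * c) + g * c = c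
    rw [hg]; noncomm_ring
  have e2 : (V.mk R : V R) = V.mk (idemRange (L v * L t)) + V.mk (idemRange (L f)) := by
    refine V.mk_eq_add_of_retracts _ _ _ _ (rangeRestrict_idemRange hw')
      (rangeRestrict_idemRange hf') fun c => ?_
    change v * (t * c) + f * c = c
    rw [← mul_assoc, hvt]; noncomm_ring
  obtain ⟨S₁, S₂, hS₁₂, c₁, c₂, h₁, h₂, hc⟩ := hR (V.mk (idemRange (L t * L v)))
    (V.mk (idemRange (L f))) (V.mk (idemRange (L g))) (by
      rw [← e1, e2, V.mk_idemRange_mul_comm hw hw'])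
  obtain ⟨B, rfl⟩ := c₁.exists_mk
  obtain ⟨D, rfl⟩ := c₂.exists_mk
  rw [V.mk_add_mk, V.mk_add_mk, V.mk_eq_mk] at hc
  obtain ⟨e⟩ := hc
  obtain ⟨α, α', δ, δ', γ, γ', hα, hα'⟩ := exists_factors_of_prod_equiv e
  let ιf : idemRange (L f) →ₗ[Rᵐᵒᵖ] R := Submodule.subtype _
  let πf : R →ₗ[Rᵐᵒᵖ] idemRange (L f) := (L f).rangeRestrict
  let ιg : idemRange (L g) →ₗ[Rᵐᵒᵖ] R := Submodule.subtype _
  let πg : R →ₗ[Rᵐᵒᵖ] idemRange (L g) := (L g).rangeRestrict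
  have hπf (c) : πf (ιf c) = c := rangeRestrict_idemRange hf' c
  have hπg (c) : πg (ιg c) = c := rangeRestrict_idemRange hg' c
  have hιf (c) : ιf (πf c) = f * c := rfl
  have hιg (c) : ιg (πg c) = g * c := rfl
  -- `β` and `β'` represent `α : f R → g R` and `α' : g R → f R`; the quasi-invertible element is
  -- `t + β`, with quasi-inverse `v + β'`
  obtain ⟨β, hβ⟩ : ∃ β : R, ∀ c, β * c = ιg (α (πf c)) :=
    ⟨L.symm (ιg ∘ₗ α ∘ₗ πf), fun c => LinearMap.congr_fun (L.apply_symm_apply _) c⟩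
  obtain ⟨β', hβ'⟩ : ∃ β' : R, ∀ c, β' * c = ιf (α' (πg c)) :=
    ⟨L.symm (ιf ∘ₗ α' ∘ₗ πg), fun c => LinearMap.congr_fun (L.apply_symm_apply _) c⟩
  have hβf : β * f = β := by
    have : πf f = πf 1 := Subtype.ext (by change f * f = f * 1; rw [hf.eq, mul_one])
    rw [hβ, this, ← hβ, mul_one]
  have hβg : β' * g = β' := by
    have : πg g = πg 1 := Subtype.ext (by change g * g = g * 1; rw [hgg.eq, mul_one])
    rw [hβ', this, ← hβ', mul_one]
  have hgβ : g * β = β := by rw [← mul_one β, hβ, ← hιg, hπg]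
  have hfβ : f * β' = β' := by rw [← mul_one β', hβ', ← hιf, hπf]
  have htβ : t * β' = 0 := by rw [← hfβ, ← mul_assoc, htf, zero_mul]
  have hβv : β * v = 0 := by rw [← hβf, mul_assoc, hfv, mul_zero]
  have hvβ : v * β = 0 := by rw [← hgβ, ← mul_assoc, hvg, zero_mul]
  have hβt : β' * t = 0 := by rw [← hβg, mul_assoc, hgt, mul_zero]
  have hu₁ : 1 - (t + β) * (v + β') = g - β * β' := by
    rw [add_mul, mul_add, mul_add, htβ, hβv, hg]; noncomm_ring
  have hu₂ : 1 - (v + β') * (t + β) = f - β' * β := by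
    rw [add_mul, mul_add, mul_add, hvβ, hβt, hvt]; noncomm_ring
  have hν (c) : ιg (γ' (γ (πg c))) = (g - β * β') * c := by
    have : γ' (γ (πg c)) = πg c - α (α' (πg c)) := eq_sub_of_add_eq' (hα' _)
    rw [this, map_sub, hιg, sub_mul, mul_assoc, hβ', hβ, hπf]
  have hμ (c) : ιf (δ' (δ (πf c))) = (f - β' * β) * c := by
    have : δ' (δ (πf c)) = πf c - α' (α (πf c)) := eq_sub_of_add_eq' (hα _)
    rw [this, map_sub, hιf, sub_mul, mul_assoc, hβ, hβ', hπg]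
  have hS₂₁ : OrthogonalOrderIdeals S₂ S₁ := ⟨hS₁₂.2.1, hS₁₂.1, by rw [inf_comm, hS₁₂.2.2]⟩
  refine ⟨(β - a) * z, v + β', v + β', fun r => ?_⟩
  have hu : a + (β - a) * z * b = t + β := by
    rw [mul_assoc, ← hfz, sub_mul, hβf, ht]; noncomm_ring
  rw [hu, hu₁, hu₂]
  exact ⟨hE.mul_mul_eq_zero_of_factor hS hS₁₂ h₁ h₂ (γ ∘ₗ πg) (ιg ∘ₗ γ') hν (δ ∘ₗ πf) (ιf ∘ₗ δ') hμ
    r, hE.mul_mul_eq_zero_of_factor hS hS₂₁ h₂ h₁ (δ ∘ₗ πf) (ιf ∘ₗ δ') hμ (γ ∘ₗ πg) (ιg ∘ₗ γ') hν r⟩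

end Exchange

end QBRings

theorem theorem8p7 (R : Type u) [Ring R] :
    (QBRings.IsQBRing R → QBRings.UnitCancellation R) ∧
    (QBRings.UnitCancellation R → QBRings.OrthogonalCancellation R) ∧
    (QBRings.IsSemiprimitive R → QBRings.IsExchangeRing R →
      (QBRings.IsQBRing R ↔ QBRings.UnitCancellation R) ∧
      (QBRings.UnitCancellation R ↔ QBRings.OrthogonalCancellation R)) :=
  ⟨fun h => h.unitCancellation, fun h => h.orthogonalCancellation, fun hS hE =>
    ⟨⟨fun h => h.unitCancellation, fun h => h.orthogonalCancellation.isQBRing hS hE⟩,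
      ⟨fun h => h.orthogonalCancellation, fun h => (h.isQBRing hS hE).unitCancellation⟩⟩⟩
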